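/- Let $a,A\in W^{1,\infty}(\mathbb S^1,\mathbb R)$, where functions on $\mathbb S^1$ are identified with $2\pi$-periodic functions of $\theta\in\mathbb R$, and let $$\widetilde a=\frac1{2\pi}\int_0^{2\pi}a(s)\,ds,\qquad \widetilde A=\frac1{2\pi}\int_0^{2\pi}A(s)\,ds .$$ Assume that $\widetilde A\in\frac12\mathbb Z\setminus\mathbb Z$. Let $L_{\mathbf A,a}$ be the operator $$L_{\mathbf A,a}\varphi=\Big(-i\frac{d}{d\theta}+A(\theta)\Big)^2\varphi+a(\theta)\varphi$$ in $L^2(\mathbb S^1,\mathbb C)$ with domain $H^2(\mathbb S^1,\mathbb C)$. Its eigenvalues, repeated according to their finite multiplicities, form a real sequence $\mu_1\le\mu_2\le\cdots$ with $\mu_k\to+\infty$, and the following holds. There exist $k^*,\ell\in\mathbb N$, $\ell\ge1$, and real numbers $\lambda_j$ ($j\in\mathbb Z$, $|j|\ge\ell$) such that the families $\{\mu_k: k>k^*\}$ and $\{\lambda_j: j\in\mathbb Z,\ |j|\ge\ell\}$ coincide, counted with multiplicity (that is, $\lambda_j=\mu_{\sigma(j)}$ for a bijection $\sigma$ from $\{j\in\mathbb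 Z:|j|\ge\ell\}$ onto $\{k: k>k^*\}$), and $$\lambda_j=\widetilde a+\Big(j+\frac12\Big)^2+O\Big(\frac1{|j|}\Big)\qquad\text{as }|j|\to+\infty .$$ Furthermore, for every $j\in\mathbb Z$ with $|j|\ge\ell$ there exist $\theta_j\in[0,2\pi]$ and an eigenfunction $\phi_j$ of $L_{\mathbf A,a}$ corresponding to the eigenvalue $\lambda_j$, normalized by $\int_0^{2\pi}|\phi_j(\theta)|^2\,d\theta=1$, such that for $\theta\in[0,2\pi]$ $$\phi_j(\theta)=\frac1{\sqrt\pi}\,e^{-i\int_0^\theta A(t)\,dt}\Big(\cos\big((j+\tfrac12)(\theta-\theta_j)\big)+R_j(\theta)\Big),$$ where $\|R_j\|_{L^\infty(0,2\pi)}=O\big(\frac1{|j|}\big)$ as $|j|\to+\infty$. -/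

import Mathlib

open MeasureTheory Filter

noncomputable section

/-! Functions on the unit circle are identified with `2π`-periodic functions of the angle, with
arc length `dθ` on one period. -/

namespace CircleMagnetic

/-- Arc length measure on one period of the circle. -/
def arc : Measure ℝ := volume.restrict (Set.Ioc 0 (2 * Real.pi))

instance : IsFiniteMeasure arc := by unfold arc; infer_instance

/-- `g` is a weak derivative of `f` on the circle: the test functions are the smooth
`2π`-periodic functions. -/
def HasWeakDeriv (f g : ℝ → ℂ) : Prop :=
  ∀ η : ℝ → ℂ, ContDiff ℝ (⊤ : ℕ∞) η → Function.Periodic η (2 * Real.pi) →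
    ∫ θ, f θ * deriv η θ ∂arc = -∫ θ, g θ * η θ ∂arc

/-- `f ∈ W^{1,∞}(𝕊¹, ℝ)`. -/
structure MemW1Infty (f : ℝ → ℝ) : Prop where
  periodic : Function.Periodic f (2 * Real.pi)
  memLp : MemLp f ⊤ arc
  weakDeriv : ∃ g : ℝ → ℝ, MemLp g ⊤ arc ∧
    HasWeakDeriv (fun θ => (f θ : ℂ)) (fun θ => (g θ : ℂ))

/-- `f ∈ H¹(𝕊¹, ℂ)` with weak derivative `g ∈ L²(𝕊¹, ℂ)`. -/
structure HasH1Deriv (f g : ℝ → ℂ) : Prop where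
  memLp : MemLp f 2 arc
  memLp_deriv : MemLp g 2 arc
  weakDeriv : HasWeakDeriv f g

/-- The mean value `(2π)⁻¹ ∫₀^{2π} f`. -/
def circleMean (f : ℝ → ℝ) : ℝ := (1 / (2 * Real.pi)) * ∫ s in (0 : ℝ)..(2 * Real.pi), f s

/-- `φ ∈ H¹(𝕊¹, ℂ)` and `(-i d/dθ + A) φ = ψ` almost everywhere. -/
def MagneticDeriv (A : ℝ → ℝ) (φ ψ : ℝ → ℂ) : Prop :=
  ∃ g : ℝ → ℂ, HasH1Deriv φ g ∧ ∀ᵐ θ ∂arc, ψ θ = -Complex.I * g θ + (A θ : ℂ) * φ θ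

/-- `φ` is in the domain of `L = (-i d/dθ + A)² + a`, i.e. `φ` and `(-i d/dθ + A) φ` are in
`H¹(𝕊¹, ℂ)` (for `A ∈ W^{1,∞}` this says `φ ∈ H²(𝕊¹, ℂ)`), and `L φ = f` almost everywhere. -/
def MagneticSchrodinger (A a : ℝ → ℝ) (φ f : ℝ → ℂ) : Prop :=
  ∃ ψ χ : ℝ → ℂ, MagneticDeriv A φ ψ ∧ MagneticDeriv A ψ χ ∧
    ∀ᵐ θ ∂arc, f θ = χ θ + (a θ : ℂ) * φ θ

theorem HasWeakDeriv.integrable_mul {f η : ℝ → ℂ} (hf : MemLp f 2 arc) (hη : Continuous η) :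
    Integrable (fun θ => f θ * η θ) arc := by
  have h1 : Integrable f arc := hf.integrable (by norm_num)
  obtain ⟨C, hC⟩ := (isCompact_Icc (a := (0 : ℝ)) (b := 2 * Real.pi)).exists_bound_of_continuousOn
    hη.continuousOn
  refine h1.mul_bdd (c := C) hη.aestronglyMeasurable ?_
  refine (ae_restrict_iff' measurableSet_Ioc).2 (ae_of_all _ fun θ hθ => ?_)
  exact hC θ (Set.Ioc_subset_Icc_self hθ)

theorem HasH1Deriv.zero : HasH1Deriv (fun _ => 0) (fun _ => 0) :=
  ⟨MemLp.zero, MemLp.zero, fun η _ _ => by simp⟩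

theorem HasH1Deriv.add {f g f' g' : ℝ → ℂ} (h : HasH1Deriv f f') (k : HasH1Deriv g g') :
    HasH1Deriv (fun θ => f θ + g θ) (fun θ => f' θ + g' θ) := by
  refine ⟨h.memLp.add k.memLp, h.memLp_deriv.add k.memLp_deriv, fun η hη hp => ?_⟩
  have hd : Continuous (deriv η) := hη.continuous_deriv (by simp)
  simp only [add_mul]
  rw [integral_add (HasWeakDeriv.integrable_mul h.memLp hd)
      (HasWeakDeriv.integrable_mul k.memLp hd),
    integral_add (HasWeakDeriv.integrable_mul h.memLp_deriv hη.continuous)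
      (HasWeakDeriv.integrable_mul k.memLp_deriv hη.continuous),
    h.weakDeriv η hη hp, k.weakDeriv η hη hp]
  ring

theorem HasH1Deriv.const_mul {f f' : ℝ → ℂ} (c : ℂ) (h : HasH1Deriv f f') :
    HasH1Deriv (fun θ => c * f θ) (fun θ => c * f' θ) := by
  refine ⟨h.memLp.const_mul c, h.memLp_deriv.const_mul c, fun η hη hp => ?_⟩
  simp only [mul_assoc]
  rw [integral_const_mul, integral_const_mul, h.weakDeriv η hη hp]
  ring

theorem MagneticDeriv.zero (A : ℝ → ℝ) : MagneticDeriv A (fun _ => 0) (fun _ => 0) :=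
  ⟨fun _ => 0, HasH1Deriv.zero, ae_of_all _ fun θ => by simp⟩

theorem MagneticDeriv.add {A : ℝ → ℝ} {φ ψ φ' ψ' : ℝ → ℂ} (h : MagneticDeriv A φ ψ)
    (k : MagneticDeriv A φ' ψ') :
    MagneticDeriv A (fun θ => φ θ + φ' θ) (fun θ => ψ θ + ψ' θ) := by
  obtain ⟨g, hg, e⟩ := h
  obtain ⟨g', hg', e'⟩ := k
  refine ⟨_, hg.add hg', ?_⟩
  filter_upwards [e, e'] with θ h1 h2
  rw [h1, h2]
  ring

theorem MagneticDeriv.const_mul {A : ℝ → ℝ} {φ ψ : ℝ → ℂ} (c : ℂ) (h : MagneticDeriv A φ ψ) :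
    MagneticDeriv A (fun θ => c * φ θ) (fun θ => c * ψ θ) := by
  obtain ⟨g, hg, e⟩ := h
  refine ⟨_, hg.const_mul c, ?_⟩
  filter_upwards [e] with θ h1
  rw [h1]
  ring

/-- The eigenspace `ker (L - z)` of `L = (-i d/dθ + A)² + a`. Elements of the domain of `L` are
represented by their (unique) continuous `2π`-periodic representatives. -/
def eigenspace (A a : ℝ → ℝ) (z : ℂ) : Submodule ℂ (ℝ → ℂ) where
  carrier := {φ | Continuous φ ∧ Function.Periodic φ (2 * Real.pi) ∧
    MagneticSchrodinger A a φ (fun θ => z * φ θ)}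
  zero_mem' := by
    refine ⟨continuous_const, fun _ => rfl, fun _ => 0, fun _ => 0, ?_, ?_, ?_⟩
    · exact MagneticDeriv.zero A
    · exact MagneticDeriv.zero A
    · exact ae_of_all _ fun θ => by simp
  add_mem' := by
    rintro φ φ' ⟨hc, hp, ψ, χ, h1, h2, h3⟩ ⟨hc', hp', ψ', χ', h1', h2', h3'⟩
    refine ⟨hc.add hc', hp.add hp', _, _, h1.add h1', h2.add h2', ?_⟩
    filter_upwards [h3, h3'] with θ e e'
    simp only [Pi.add_apply, mul_add, e, e']
    ring
  smul_mem' := by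
    rintro c φ ⟨hc, hp, ψ, χ, h1, h2, h3⟩
    refine ⟨hc.const_smul c, fun θ => by simp [hp θ], _, _, h1.const_mul c, h2.const_mul c, ?_⟩
    filter_upwards [h3] with θ e
    simp only [Pi.smul_apply, smul_eq_mul]
    linear_combination c * e

/-- `μ₁ ≤ μ₂ ≤ ⋯ → +∞` is the sequence of all eigenvalues of `L = (-i d/dθ + A)² + a`, each
repeated according to its (finite) multiplicity. -/
structure IsEigenvalueSequence (A a : ℝ → ℝ) (μ : ℕ+ → ℝ) : Prop where
  mono : Monotone μ
  tendsto : Tendsto μ atTop atTop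
  finite_mult : ∀ z : ℂ, FiniteDimensional ℂ (eigenspace A a z)
  count : ∀ z : ℂ, {k : ℕ+ | (μ k : ℂ) = z}.ncard = Module.finrank ℂ (eigenspace A a z)

end CircleMagnetic

end

/-!
The functions `e_m(θ) = (2π)^{-1/2} exp(i((m + 1/2)θ - ∫₀^θ A))`, which are periodic because the
mean of `A` is a half-integer, form an orthonormal basis of `L²(𝕊¹)` in which `-i d/dθ + A` is
diagonal with entries `m + 1/2`. Hence `L` is `diag((m + 1/2)²)` perturbed by the bounded symmetric
operator of multiplication by `a`. The modes `n` and `-1 - n` share the free eigenvalue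
`(n + 1/2)²`, and comparing dimensions of spectral subspaces shows that for large `n` exactly two
eigenvalues lie in `(n², (n + 1)²]`. In a corresponding eigenvector, the coefficients on all other
modes have `ℓ¹`-norm `O(1/n)`, because the free eigenvalue of a mode `m` has distance of order at
least `n · min(|m - n|, |m + 1 + n|)` from `(n², (n + 1)²]`.

The antilinear map `f ↦ e^{-2i∫A} conj f` commutes with `L` and exchanges the modes `m` and
`-1 - m`, so eigenvectors can be chosen with conjugate coefficients on the two leading modes, which
then add up to a cosine. The matrix element of `a` between these two modes is a Fourier coefficient
of order `2n + 1`, hence `O(1/n)` as `a` has a weak derivative; this gives the eigenvalue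
asymptotics.
-/

open scoped InnerProductSpace

universe u

section HilbertSpace

variable {ι κ : Type*} {H : Type u} [NormedAddCommGroup H] [InnerProductSpace ℂ H]

theorem hasSum_sq_norm_inner (b : HilbertBasis ι ℂ H) (x : H) :
    HasSum (fun i => ‖⟪b i, x⟫_ℂ‖ ^ 2) (‖x‖ ^ 2) := by
  simpa [b.repr_apply_apply] using lp.hasSum_norm (p := 2) (by norm_num) (b.repr x)

theorem eq_of_forall_inner_eq (b : HilbertBasis ι ℂ H) {x y : H}
    (h : ∀ i, ⟪b i, x⟫_ℂ = ⟪b i, y⟫_ℂ) : x = y :=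
  b.repr.injective <| lp.ext <| funext fun i => by simpa only [b.repr_apply_apply] using h i

theorem norm_sq_sum_smul_of_orthonormal [Fintype κ] {u : κ → H} (hu : Orthonormal ℂ u) (x : κ → ℂ) :
    ‖∑ i, x i • u i‖ ^ 2 = ∑ i, ‖x i‖ ^ 2 := by
  simpa using hu.orthogonalFamily.norm_sum x Finset.univ

theorem exists_ne_zero_forall_inner_sum_eq_zero [Fintype ι] [Fintype κ] (v : ι → H) (u : κ → H)
    (hcard : Fintype.card ι < Fintype.card κ) :
    ∃ x : κ → ℂ, x ≠ 0 ∧ ∀ m, ⟪v m, ∑ i, x i • u i⟫_ℂ = 0 := by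
  let f : (κ → ℂ) →ₗ[ℂ] ι → ℂ :=
    LinearMap.pi fun m => (innerₛₗ ℂ (v m)).comp (Fintype.linearCombination ℂ u)
  have hker : LinearMap.ker f ≠ ⊥ := LinearMap.ker_ne_bot_of_finrank_lt (by simpa using hcard)
  obtain ⟨x, hx, hx0⟩ := Submodule.exists_mem_ne_zero_of_ne_bot hker
  exact ⟨x, hx0, fun m => congrFun hx m⟩

theorem exists_hilbertBasis_comp_equiv [CompleteSpace H] (u : HilbertBasis κ ℂ H) (σ : ι ≃ κ) :
    ∃ v : HilbertBasis ι ℂ H, ⇑v = u ∘ σ := by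
  have hspan : ⊤ ≤ (Submodule.span ℂ (Set.range (u ∘ σ))).topologicalClosure := by
    rw [σ.surjective.range_comp, u.dense_span]
  exact ⟨HilbertBasis.mk (u.orthonormal.comp σ σ.injective) hspan, HilbertBasis.coe_mk _ _⟩

theorem exists_hilbertBasis_apply_eq_smul [CompleteSpace H] {K : H →L[ℂ] H}
    (hK : IsCompactOperator K) (hs : K.IsSymmetric) :
    ∃ (κ : Type u) (u : HilbertBasis κ ℂ H) (e : κ → ℝ), ∀ i, K (u i) = (e i : ℂ) • u i := by
  let E : ℂ → Submodule ℂ H := fun z => Module.End.eigenspace (K : Module.End ℂ H) z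
  have hmem : ∀ {z x}, x ∈ E z ↔ K x = z • x := Module.End.mem_eigenspace_iff
  have hclosed : ∀ z, IsClosed (E z : Set H) := fun z => by
    rw [show (E z : Set H) = {x | K x = z • x} from Set.ext fun x => hmem]
    exact isClosed_eq K.continuous (continuous_const_smul z)
  have hcomplete : ∀ z, CompleteSpace (E z) := fun z => (hclosed z).completeSpace_coe
  choose w v _ using fun z => exists_hilbertBasis ℂ (E z)
  have hon := hs.orthogonalFamily_eigenspaces.orthonormal_sigma_orthonormal
    fun z => (v z).orthonormal
  have hbot :
      (Submodule.span ℂ (Set.range fun a : Σ z, w z => ((v a.1 a.2 : E a.1) : H)))ᗮ = ⊥ := by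
    rw [eq_bot_iff, ← ContinuousLinearMap.orthogonalComplement_iSup_eigenspaces_eq_bot hK hs,
      ← Submodule.iInf_orthogonal]
    refine fun x hx => Submodule.mem_iInf _ |>.2 fun z => ?_
    rw [← Submodule.orthogonalProjectionOnto_eq_zero_iff]
    refine eq_of_forall_inner_eq (v z) fun i => ?_
    rw [Submodule.inner_orthogonalProjectionOnto_eq_of_mem_left, inner_zero_right]
    exact hx _ (Submodule.subset_span ⟨⟨z, i⟩, rfl⟩)
  let u := HilbertBasis.mkOfOrthogonalEqBot hon hbot
  refine ⟨_, u, fun a => a.1.re, fun a => ?_⟩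
  have hKu : K (u a) = a.1 • u a := by
    rw [show u a = (v a.1 a.2 : E a.1) from
      congrFun (HilbertBasis.coe_mkOfOrthogonalEqBot hon hbot) a]
    exact hmem.1 (v a.1 a.2).2
  have hreal := hs.conj_eigenvalue_eq_self (Module.End.hasEigenvalue_of_hasEigenvector
    ⟨hmem.2 hKu, u.orthonormal.ne_zero a⟩)
  rw [hKu, Complex.conj_eq_iff_re.1 hreal]

/-- `x` is in the domain of the self-adjoint operator `D` that is diagonal in the Hilbert basis `b`
with eigenvalues `d`, and `D x = y`. -/
def IsDiagonalImage (b : HilbertBasis ι ℂ H) (d : ι → ℝ) (x y : H) : Prop :=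
  ∀ m, ⟪b m, y⟫_ℂ = d m * ⟪b m, x⟫_ℂ

namespace IsDiagonalImage

variable {b : HilbertBasis ι ℂ H} {d : ι → ℝ} {x y x' y' : H}

theorem zero (b : HilbertBasis ι ℂ H) (d : ι → ℝ) : IsDiagonalImage b d 0 0 := fun m => by simp

theorem add (h : IsDiagonalImage b d x y) (h' : IsDiagonalImage b d x' y') :
    IsDiagonalImage b d (x + x') (y + y') := fun m => by
  simp only [inner_add_right, h m, h' m, mul_add]

theorem smul (c : ℂ) (h : IsDiagonalImage b d x y) : IsDiagonalImage b d (c • x) (c • y) :=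
  fun m => by simp only [inner_smul_right, h m, mul_left_comm]

theorem sum {F : Finset κ} {v w : κ → H} (h : ∀ i ∈ F, IsDiagonalImage b d (v i) (w i)) :
    IsDiagonalImage b d (∑ i ∈ F, v i) (∑ i ∈ F, w i) := fun m => by
  simp only [inner_sum, Finset.mul_sum]
  exact Finset.sum_congr rfl fun i hi => h i hi m

theorem sub_smul (c : ℝ) (h : IsDiagonalImage b d x y) :
    IsDiagonalImage b (fun m => d m - c) x (y - (c : ℂ) • x) := fun m => by
  simp only [inner_sub_right, inner_smul_right, h m, Complex.ofReal_sub, sub_mul]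

theorem basis (b : HilbertBasis ι ℂ H) (d : ι → ℝ) (m : ι) :
    IsDiagonalImage b d (b m) ((d m : ℂ) • b m) := fun k => by
  classical
  rw [inner_smul_right, orthonormal_iff_ite.1 b.orthonormal k m]
  split_ifs with hk
  · rw [hk]
  · simp

theorem inner_left_eq_inner_right (h : IsDiagonalImage b d x y) (h' : IsDiagonalImage b d x' y') :
    ⟪y, x'⟫_ℂ = ⟪x, y'⟫_ℂ := by
  refine (b.hasSum_inner_mul_inner y x').unique ?_
  convert b.hasSum_inner_mul_inner x y' using 2 with m
  rw [h' m, ← inner_conj_symm y, h m, map_mul, Complex.conj_ofReal, inner_conj_symm]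
  ring

theorem mul_norm_le {ρ : ℝ} (hρ : 0 ≤ ρ) (h : IsDiagonalImage b d x y)
    (hd : ∀ m, ⟪b m, x⟫_ℂ ≠ 0 → ρ ≤ |d m|) : ρ * ‖x‖ ≤ ‖y‖ := by
  refine le_of_sq_le_sq ?_ (norm_nonneg y)
  rw [mul_pow]
  refine hasSum_le (fun m => ?_) ((hasSum_sq_norm_inner b x).mul_left (ρ ^ 2))
    (hasSum_sq_norm_inner b y)
  rw [h m, norm_mul, mul_pow, Complex.norm_real, Real.norm_eq_abs]
  by_cases hx : ⟪b m, x⟫_ℂ = 0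
  · simp [hx]
  · gcongr
    exact hd m hx

theorem abs_mul_norm_inner_le (h : IsDiagonalImage b d x y) (m : ι) :
    |d m| * ‖⟪b m, x⟫_ℂ‖ ≤ ‖y‖ := by
  have hcauchy := norm_inner_le_norm (𝕜 := ℂ) (b m) y
  rwa [h m, norm_mul, Complex.norm_real, Real.norm_eq_abs, b.orthonormal.1 m, one_mul] at hcauchy

theorem summable_norm_inner (h : IsDiagonalImage b d x y) (hd : ∀ m, 0 ≤ d m)
    (hsum : Summable fun m => (d m + 1)⁻¹) : Summable fun m => ‖⟪b m, x⟫_ℂ‖ := by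
  refine Summable.of_nonneg_of_le (fun _ => norm_nonneg _) (fun m => ?_)
    (hsum.mul_left (‖y‖ + ‖x‖))
  have hx := norm_inner_le_norm (𝕜 := ℂ) (b m) x
  have hy := h.abs_mul_norm_inner_le m
  rw [b.orthonormal.1 m, one_mul] at hx
  rw [abs_of_nonneg (hd m)] at hy
  rw [← div_eq_mul_inv, le_div_iff₀ (by linarith [hd m])]
  linarith

theorem summable_abs_mul_sq_norm_inner (h : IsDiagonalImage b d x y)
    (hsum : Summable fun m => ‖⟪b m, x⟫_ℂ‖) : Summable fun m => |d m| * ‖⟪b m, x⟫_ℂ‖ ^ 2 := by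
  refine Summable.of_nonneg_of_le (fun _ => by positivity) (fun m => ?_) (hsum.mul_left ‖y‖)
  rw [sq, ← mul_assoc]
  exact mul_le_mul_of_nonneg_right (h.abs_mul_norm_inner_le m) (norm_nonneg _)

end IsDiagonalImage

theorem exists_isCompactOperator_isDiagonalImage [CompleteSpace H] (b : HilbertBasis ι ℂ H)
    {d : ι → ℝ} (hd : ∀ m, d m ≠ 0) (hsum : Summable fun m => (d m)⁻¹) :
    ∃ R : H →L[ℂ] H, IsCompactOperator R ∧ ∀ x, IsDiagonalImage b d (R x) x := by
  classical
  let P : ι → H →L[ℂ] H := fun m => ((d m)⁻¹ : ℂ) • (innerSL ℂ (b m)).smulRight (b m)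
  have hP : HasSum P (∑' m, P m) := by
    refine (Summable.of_norm_bounded hsum.norm fun m => le_of_eq ?_).hasSum
    simp [P, norm_smul, b.orthonormal.1 m]
  refine ⟨∑' m, P m, isCompactOperator_of_tendsto hP (Eventually.of_forall fun s => ?_),
    fun x m => ?_⟩
  · change ∑ m ∈ s, P m ∈ compactOperator (RingHom.id ℂ) H H
    refine Submodule.sum_mem _ fun m _ => Submodule.smul_mem _ _ ?_
    have hrank_one : IsCompactOperator ((ContinuousLinearMap.id ℂ ℂ).smulRight (b m)) :=
      isCompactOperator_of_locallyCompactSpace_rng _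
    exact hrank_one.comp_clm (innerSL ℂ (b m))
  · have hcoef := hP.mapL ((innerSL ℂ (b m)).comp (ContinuousLinearMap.apply ℂ H x))
    have heval : ⟪b m, (∑' k, P k) x⟫_ℂ = (d m : ℂ)⁻¹ * ⟪b m, x⟫_ℂ := by
      refine hcoef.unique ?_
      convert! hasSum_ite_eq m ((d m : ℂ)⁻¹ * ⟪b m, x⟫_ℂ) using 2 with k
      simp only [P, ContinuousLinearMap.comp_apply, ContinuousLinearMap.apply_apply,
        _root_.smul_apply, ContinuousLinearMap.smulRight_apply, innerSL_apply_apply,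
        inner_smul_right, orthonormal_iff_ite.1 b.orthonormal m k, eq_comm (a := m)]
      split_ifs with hk
      · rw [hk, mul_one]
      · simp
    rw [heval, mul_inv_cancel_left₀ (by exact_mod_cast hd m)]

/-- The eigenspace at `z` of `D + V`, where `D` is diagonal in the Hilbert basis `b` with
eigenvalues `d`. -/
def perturbedEigenspace (b : HilbertBasis ι ℂ H) (d : ι → ℝ) (V : H →L[ℂ] H) (z : ℂ) :
    Submodule ℂ H where
  carrier := {x | IsDiagonalImage b d x (z • x - V x)}
  zero_mem' := by simpa using IsDiagonalImage.zero b d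
  add_mem' {x y} hx hy := by
    have h := IsDiagonalImage.add hx hy
    rwa [sub_add_sub_comm, ← smul_add, ← map_add] at h
  smul_mem' c x hx := by
    have h := IsDiagonalImage.smul c hx
    rwa [smul_sub, smul_comm, ← map_smul] at h

namespace perturbedEigenspace

variable {b : HilbertBasis ι ℂ H} {d : ι → ℝ} {V : H →L[ℂ] H}

theorem inner_eq_zero (hV : V.IsSymmetric) {z : ℂ} {r : ℝ} {x y : H}
    (hx : x ∈ perturbedEigenspace b d V z) (hy : y ∈ perturbedEigenspace b d V r)
    (hz : z ≠ r) : ⟪y, x⟫_ℂ = 0 := by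
  have hD := IsDiagonalImage.inner_left_eq_inner_right hy hx
  have hVxy : ⟪V y, x⟫_ℂ = ⟪y, V x⟫_ℂ := hV y x
  rw [inner_sub_left, inner_sub_right, inner_smul_left, inner_smul_right, Complex.conj_ofReal,
    hVxy, sub_left_inj] at hD
  exact (mul_eq_zero.1 (by linear_combination hD : ((r : ℂ) - z) * ⟪y, x⟫_ℂ = 0)).resolve_left
    (sub_ne_zero.2 hz.symm)

theorem eq_span (hV : V.IsSymmetric) (u : HilbertBasis κ ℂ H) {e : κ → ℝ}
    (hu : ∀ i, u i ∈ perturbedEigenspace b d V (e i)) {z : ℂ} (hfin : {i | (e i : ℂ) = z}.Finite) :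
    perturbedEigenspace b d V z =
      Submodule.span ℂ (Set.range fun i : {i | (e i : ℂ) = z} => u i) := by
  refine le_antisymm (fun x hx => ?_) (Submodule.span_le.2 ?_)
  · have hcoef : ∀ i ∉ hfin.toFinset, u.repr x i • u i = 0 := fun i hi => by
      rw [u.repr_apply_apply, inner_eq_zero hV hx (hu i) fun hz => hi (by simp [hz]), zero_smul]
    rw [(u.hasSum_repr x).unique (hasSum_sum_of_ne_finset_zero hcoef)]
    refine Submodule.sum_mem _ fun i hi => Submodule.smul_mem _ _ (Submodule.subset_span ?_)
    exact ⟨⟨i, by simpa using hi⟩, rfl⟩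
  · rintro _ ⟨⟨i, hi⟩, rfl⟩
    exact (show (e i : ℂ) = z from hi) ▸ hu i

theorem finiteDimensional_and_ncard_eq_finrank (hV : V.IsSymmetric) (u : HilbertBasis κ ℂ H)
    {e : κ → ℝ} (hu : ∀ i, u i ∈ perturbedEigenspace b d V (e i)) {z : ℂ}
    (hfin : {i | (e i : ℂ) = z}.Finite) :
    FiniteDimensional ℂ (perturbedEigenspace b d V z) ∧
      {i | (e i : ℂ) = z}.ncard = Module.finrank ℂ (perturbedEigenspace b d V z) := by
  have := hfin.fintype
  have hli : LinearIndependent ℂ fun i : {i | (e i : ℂ) = z} => u i :=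
    (u.orthonormal.comp _ Subtype.coe_injective).linearIndependent
  rw [eq_span hV u hu hfin, finrank_span_eq_card hli, ← Nat.card_eq_fintype_card]
  exact ⟨FiniteDimensional.span_of_finite ℂ (Set.finite_range _),
    (Nat.card_coe_set_eq _).symm⟩

theorem basis_mem_neg (hV : V.IsSymmetric) {u : HilbertBasis κ ℂ H} {e : κ → ℝ}
    (hu : ∀ i, u i ∈ perturbedEigenspace b d V (e i)) (m : ι) :
    b m ∈ perturbedEigenspace u e (-V) (d m) := fun i => by
  have hD := IsDiagonalImage.inner_left_eq_inner_right (hu i) (IsDiagonalImage.basis b d m)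
  have hVm : ⟪V (u i), b m⟫_ℂ = ⟪u i, V (b m)⟫_ℂ := hV _ _
  rw [inner_sub_left, inner_smul_left, Complex.conj_ofReal, hVm] at hD
  rw [_root_.neg_apply, sub_neg_eq_add, inner_add_right, ← hD]
  ring

/-- If `u` had more eigenvectors near `c` than `b`, some combination of them would be orthogonal to
all basis vectors near `c`; `D - c` is too large on it to be compensated by `V`. -/
theorem card_le_card {u : κ → H} (hon : Orthonormal ℂ u) {e : κ → ℝ}
    (hu : ∀ i, u i ∈ perturbedEigenspace b d V (e i)) {c r ρ : ℝ} (hr : 0 ≤ r)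
    (hρ : r + ‖V‖ < ρ) (F : Finset κ) (hF : ∀ i ∈ F, |e i - c| ≤ r) (M : Finset ι)
    (hM : ∀ m ∉ M, ρ ≤ |d m - c|) : F.card ≤ M.card := by
  by_contra! hlt
  obtain ⟨x, hx0, hx⟩ := exists_ne_zero_forall_inner_sum_eq_zero (fun m : M => b m)
    (fun i : F => u i) (by simpa using hlt)
  have honF : Orthonormal ℂ fun i : F => u i := hon.comp _ Subtype.coe_injective
  set w := ∑ i : F, x i • u i with hw
  set g := ∑ i : F, (((e i - c : ℝ) : ℂ) * x i) • u i with hg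
  have hwpos : 0 < ‖w‖ := norm_pos_iff.2 fun h0 => hx0 <| funext <|
    Fintype.linearIndependent_iff.1 honF.linearIndependent x h0
  have hgw : ‖g‖ ≤ r * ‖w‖ := by
    refine le_of_sq_le_sq ?_ (by positivity)
    rw [mul_pow, hg, norm_sq_sum_smul_of_orthonormal honF, hw, norm_sq_sum_smul_of_orthonormal honF,
      Finset.mul_sum]
    refine Finset.sum_le_sum fun i _ => ?_
    rw [norm_mul, mul_pow, Complex.norm_real, Real.norm_eq_abs]
    gcongr
    exact hF i i.2
  have hD : IsDiagonalImage b (fun m => d m - c) w (g - V w) := by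
    have hsum := (IsDiagonalImage.sum (F := Finset.univ) fun (i : F) _ =>
      (hu i).smul (x i)).sub_smul c
    convert! hsum using 1
    simp only [hw, hg, map_sum, map_smul, Finset.smul_sum, ← Finset.sum_sub_distrib]
    refine Finset.sum_congr rfl fun i _ => ?_
    push_cast
    module
  have hlower : ρ * ‖w‖ ≤ ‖g - V w‖ :=
    hD.mul_norm_le (by linarith [norm_nonneg V]) fun m hm => hM m fun hmM => hm (hx ⟨m, hmM⟩)
  have hupper : ‖g - V w‖ ≤ r * ‖w‖ + ‖V‖ * ‖w‖ :=
    (norm_sub_le _ _).trans (add_le_add hgw (V.le_opNorm w))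
  nlinarith

theorem exists_compact_resolvent [CompleteSpace H] (b : HilbertBasis ι ℂ H) (V : H →L[ℂ] H)
    {s : ℝ} (hs : ‖V‖ < s) (hd : ∀ m, s ≤ d m) (hsum : Summable fun m => (d m)⁻¹) :
    ∃ K : H →L[ℂ] H, IsCompactOperator K ∧ ∀ x, IsDiagonalImage b d (K x) (x - V (K x)) := by
  have hs0 : 0 < s := (norm_nonneg V).trans_lt hs
  obtain ⟨R, hRcompact, hR⟩ := exists_isCompactOperator_isDiagonalImage b
    (fun m => (hs0.trans_le (hd m)).ne') hsum
  have hRnorm : ‖R‖ ≤ s⁻¹ := R.opNorm_le_bound (by positivity) fun x => by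
    rw [← div_eq_inv_mul, le_div_iff₀' hs0]
    exact (hR x).mul_norm_le hs0.le fun m _ => (hd m).trans (le_abs_self _)
  have hVR : ‖-(V * R)‖ < 1 := by
    rw [norm_neg]
    calc ‖V * R‖ ≤ ‖V‖ * ‖R‖ := norm_mul_le _ _
      _ ≤ ‖V‖ * s⁻¹ := by gcongr
      _ < 1 := by rwa [← div_eq_mul_inv, div_lt_one hs0]
  let B := Units.oneSub _ hVR
  have hB : ∀ x, (↑B⁻¹ : H →L[ℂ] H) x = x - V (R ((↑B⁻¹ : H →L[ℂ] H) x)) := fun x => by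
    have h := DFunLike.congr_fun B.mul_inv x
    simp only [B, Units.val_oneSub, sub_neg_eq_add, mul_apply_eq_comp, _root_.add_apply,
      one_apply_eq_self] at h
    exact eq_sub_of_add_eq h
  refine ⟨R * ↑B⁻¹, hRcompact.comp_clm _, fun x => ?_⟩
  have hx := hR ((↑B⁻¹ : H →L[ℂ] H) x)
  nth_rewrite 2 [hB] at hx
  exact hx

theorem exists_hilbertBasis_mem [CompleteSpace H] (b : HilbertBasis ι ℂ H) (hV : V.IsSymmetric)
    (hd : ∀ m, 0 ≤ d m) (hsum : Summable fun m => (d m + 1)⁻¹) :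
    ∃ (κ : Type u) (u : HilbertBasis κ ℂ H) (e : κ → ℝ),
      ∀ i, u i ∈ perturbedEigenspace b d V (e i) := by
  set s := ‖V‖ + 1
  have hsumV : Summable fun m => (d m + s)⁻¹ := by
    refine hsum.of_nonneg_of_le (fun m => ?_) fun m => ?_
    · have := hd m
      positivity
    · gcongr
      · linarith [hd m]
      · linarith [norm_nonneg V]
  obtain ⟨K, hKcompact, hK⟩ := exists_compact_resolvent b V (s := s) (lt_add_one _)
    (fun m => le_add_of_nonneg_left (hd m)) hsumV
  have hKsymm : K.IsSymmetric := fun x y => by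
    have hD := (hK x).inner_left_eq_inner_right (hK y)
    have hVK : ⟪V (K x), K y⟫_ℂ = ⟪K x, V (K y)⟫_ℂ := hV _ _
    rw [inner_sub_left, inner_sub_right, hVK, sub_left_inj] at hD
    exact hD.symm
  obtain ⟨κ, u, e, he⟩ := exists_hilbertBasis_apply_eq_smul hKcompact hKsymm
  refine ⟨κ, u, fun i => (e i)⁻¹ - s, fun i => ?_⟩
  have hKu := hK (u i)
  rw [he i] at hKu
  have he0 : (e i : ℂ) ≠ 0 := fun h0 => u.orthonormal.ne_zero i <|
    eq_of_forall_inner_eq b fun m => by simpa [h0] using hKu m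
  have hres := (hKu.smul (e i : ℂ)⁻¹).sub_smul s
  simp only [add_sub_cancel_right, inv_smul_smul₀ he0, map_smul, smul_sub] at hres
  change IsDiagonalImage b d (u i) _
  convert hres using 1
  push_cast
  module

end perturbedEigenspace

end HilbertSpace

section Enumeration

theorem nonempty_orderIso_nat_of_finite_Iic {κ : Type*} [LinearOrder κ] [Infinite κ]
    (hIic : ∀ j : κ, (Set.Iic j).Finite) : Nonempty (κ ≃o ℕ) := by
  classical
  obtain ⟨j⟩ : Nonempty κ := inferInstance
  obtain ⟨i, hij, hmin⟩ := (hIic j).exists_minimal ⟨j, le_rfl⟩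
  have hi : ∀ k, i ≤ k := fun k => (le_total i k).elim id fun h => hmin (h.trans hij) h
  let : OrderBot κ := { bot := i, bot_le := hi }
  let : LocallyFiniteOrder κ := LocallyFiniteOrder.ofFiniteIcc fun i j =>
    (hIic j).subset fun _ hx => hx.2
  have : NoMaxOrder κ := ⟨fun i => by
    by_contra! h
    exact Set.infinite_univ.mono (fun x _ => h x) (hIic i)⟩
  let : SuccOrder κ := LinearLocallyFiniteOrder.succOrder κ
  let : PredOrder κ := LinearLocallyFiniteOrder.predOrder κ
  exact ⟨orderIsoNatOfLinearSuccPredArch⟩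

theorem exists_pnat_equiv_monotone {κ : Type*} [Infinite κ] (e : κ → ℝ)
    (hfin : ∀ x, {i | e i ≤ x}.Finite) : ∃ σ : ℕ+ ≃ κ, Monotone (e ∘ σ) := by
  have hcount : Countable κ := by
    have hcover : (Set.univ : Set κ) = ⋃ n : ℕ, {i | e i ≤ n} := by
      ext i
      simpa using exists_nat_ge (e i)
    rw [← Set.countable_univ_iff, hcover]
    exact Set.countable_iUnion fun n => (hfin n).countable
  obtain ⟨g, hg⟩ := exists_injective_nat κ
  let f : κ → ℝ ×ₗ ℕ := fun i => toLex (e i, g i)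
  have hf : Function.Injective f := fun i j h => hg (congrArg (fun p => (ofLex p).2) h)
  let : LinearOrder κ := LinearOrder.lift' f hf
  have hmono : Monotone e := fun i j hij =>
    (Prod.Lex.le_iff.1 (show f i ≤ f j from hij)).elim le_of_lt fun h => h.1.le
  obtain ⟨τ⟩ := nonempty_orderIso_nat_of_finite_Iic fun j : κ =>
    (hfin (e j)).subset fun _ hi => hmono hi
  exact ⟨Equiv.pnatEquivNat.trans τ.symm.toEquiv, fun k l hkl =>
    hmono (τ.symm.monotone (by simpa using hkl))⟩

theorem finite_setOf_le_of_tendsto_atTop {μ : ℕ+ → ℝ} (htend : Tendsto μ atTop atTop) (x : ℝ) :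
    {k | μ k ≤ x}.Finite := by
  obtain ⟨K, hK⟩ := (htend.eventually_gt_atTop x).exists_forall_of_atTop
  exact (Set.finite_Iio K).subset fun k hk => lt_of_not_ge fun hKk => (hK k hKk).not_ge hk

theorem finite_setOf_le_of_summable_inv {ι : Type*} {d : ι → ℝ} (hd : ∀ m, 0 ≤ d m)
    (hsum : Summable fun m => (d m + 1)⁻¹) (x : ℝ) : {m | d m ≤ x}.Finite := by
  have hx : 0 < (|x| + 1)⁻¹ := by positivity
  refine (Filter.eventually_cofinite.1
    (hsum.tendsto_cofinite_zero.eventually_lt_const hx)).subset fun m hm => ?_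
  have hm : d m ≤ x := hm
  have := hd m
  exact not_lt.2 (inv_anti₀ (by positivity) (by linarith [le_abs_self x]))

end Enumeration

section DiagonalPerturbation

variable {ι κ : Type*} {H : Type u} [NormedAddCommGroup H] [InnerProductSpace ℂ H]
  {b : HilbertBasis ι ℂ H} {d : ι → ℝ} {V : H →L[ℂ] H}

theorem infinite_of_hilbertBasis [Infinite ι] (b : HilbertBasis ι ℂ H)
    (u : HilbertBasis κ ℂ H) : Infinite κ := by
  by_contra hfin
  rw [not_infinite_iff_finite] at hfin
  have := Fintype.ofFinite κ
  have : FiniteDimensional ℂ H := u.toOrthonormalBasis.toBasis.finiteDimensional_of_finite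
  exact not_finite_iff_infinite.2 ‹Infinite ι› b.orthonormal.linearIndependent.finite

namespace perturbedEigenspace

theorem isDiagonalImage_sub {lam : ℝ} {x : H} (hx : x ∈ perturbedEigenspace b d V lam) :
    IsDiagonalImage b (fun m => d m - lam) x (-V x) := by
  have h := IsDiagonalImage.sub_smul lam hx
  rwa [sub_sub_cancel_left] at h

theorem neg_norm_le (hd : ∀ m, 0 ≤ d m) {lam : ℝ} {x : H}
    (hx : x ∈ perturbedEigenspace b d V lam) (hx0 : x ≠ 0) : -‖V‖ ≤ lam := by
  by_contra! hlt
  have hlower := (isDiagonalImage_sub hx).mul_norm_le (ρ := -lam)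
    (by linarith [norm_nonneg V]) fun m _ => le_abs.2 (Or.inl (by linarith [hd m]))
  rw [norm_neg] at hlower
  nlinarith [V.le_opNorm x, norm_pos_iff.2 hx0]

theorem finite_setOf_le {u : κ → H} (hon : Orthonormal ℂ u) {e : κ → ℝ}
    (hu : ∀ i, u i ∈ perturbedEigenspace b d V (e i)) (hd : ∀ m, 0 ≤ d m)
    (hfin : ∀ x, {m | d m ≤ x}.Finite) (x : ℝ) : {i | e i ≤ x}.Finite := by
  set r := max |x| ‖V‖
  set M := (hfin (r + ‖V‖ + 1)).toFinset with hM
  refine Set.not_infinite.1 fun hinf => ?_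
  obtain ⟨F, hF, hcard⟩ := hinf.exists_subset_card_eq (M.card + 1)
  have hle := card_le_card hon hu (c := 0) (r := r) (ρ := r + ‖V‖ + 1)
    ((abs_nonneg x).trans (le_max_left _ _)) (lt_add_one _) F (fun i hi => ?_) M fun m hm => ?_
  · omega
  · have hei : e i ≤ x := hF hi
    rw [sub_zero, abs_le]
    exact ⟨(neg_le_neg (le_max_right _ _)).trans (neg_norm_le hd (hu i) (hon.ne_zero i)),
      hei.trans ((le_abs_self x).trans (le_max_left _ _))⟩
  · simp only [hM, Set.Finite.mem_toFinset, Set.mem_ofPred_eq, not_le] at hm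
    rw [sub_zero]
    exact hm.le.trans (le_abs_self _)

theorem exists_sorted_hilbertBasis_mem [CompleteSpace H] [Infinite ι] (b : HilbertBasis ι ℂ H)
    (hV : V.IsSymmetric) (hd : ∀ m, 0 ≤ d m) (hsum : Summable fun m => (d m + 1)⁻¹) :
    ∃ (u : HilbertBasis ℕ+ ℂ H) (μ : ℕ+ → ℝ), Monotone μ ∧ Tendsto μ atTop atTop ∧
      ∀ k, u k ∈ perturbedEigenspace b d V (μ k) := by
  obtain ⟨κ, u, e, hu⟩ := exists_hilbertBasis_mem b hV hd hsum
  have hfin : ∀ x, {i | e i ≤ x}.Finite :=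
    finite_setOf_le u.orthonormal hu hd (finite_setOf_le_of_summable_inv hd hsum)
  have := infinite_of_hilbertBasis b u
  obtain ⟨σ, hσ⟩ := exists_pnat_equiv_monotone e hfin
  obtain ⟨v, hv⟩ := exists_hilbertBasis_comp_equiv u σ
  refine ⟨v, e ∘ σ, hσ, tendsto_atTop_atTop_of_monotone hσ fun x => ?_, fun k => ?_⟩
  · by_contra! h
    exact Set.infinite_univ.mono (fun i _ => by simpa using (h (σ.symm i)).le) (hfin x)
  · rw [hv]
    exact hu (σ k)

end perturbedEigenspace

/-- The component of `x` orthogonal to the basis vectors `b p` and `b q`. -/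
noncomputable def pairRemainder (b : HilbertBasis ι ℂ H) (p q : ι) (x : H) : H :=
  x - (⟪b p, x⟫_ℂ • b p + ⟪b q, x⟫_ℂ • b q)

namespace pairRemainder

variable {p q : ι} {x : H}

theorem hasSum_inner_smul {E : Type*} [AddCommGroup E] [Module ℂ E] [TopologicalSpace E]
    [IsTopologicalAddGroup E] {f : ι → E} {s : E} (hs : HasSum (fun m => ⟪b m, x⟫_ℂ • f m) s)
    (p q : ι) : HasSum (fun m => ⟪b m, pairRemainder b p q x⟫_ℂ • f m)
      (s - (⟪b p, x⟫_ℂ • f p + ⟪b q, x⟫_ℂ • f q)) := by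
  classical
  have hsingle : ∀ k, HasSum (fun m => (⟪b k, x⟫_ℂ * ⟪b m, b k⟫_ℂ) • f m) (⟪b k, x⟫_ℂ • f k) := by
    intro k
    convert! hasSum_ite_eq k (⟪b k, x⟫_ℂ • f k) using 2 with m
    rw [orthonormal_iff_ite.1 b.orthonormal]
    split_ifs with hm <;> simp [hm]
  convert! hs.sub ((hsingle p).add (hsingle q)) using 2 with m
  simp only [pairRemainder, inner_sub_right, inner_add_right, inner_smul_right, sub_smul, add_smul]

theorem inner_of_ne {m : ι} (hp : m ≠ p) (hq : m ≠ q) :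
    ⟪b m, pairRemainder b p q x⟫_ℂ = ⟪b m, x⟫_ℂ := by
  simp [pairRemainder, b.orthonormal.2 hp, b.orthonormal.2 hq]

theorem inner_left (hpq : p ≠ q) : ⟪b p, pairRemainder b p q x⟫_ℂ = 0 := by
  simp [pairRemainder, b.orthonormal.2 hpq, b.orthonormal.1 p]

theorem inner_right (hpq : p ≠ q) : ⟪b q, pairRemainder b p q x⟫_ℂ = 0 := by
  simp [pairRemainder, b.orthonormal.2 hpq.symm, b.orthonormal.1 q]

theorem norm_sq (hpq : p ≠ q) :
    ‖pairRemainder b p q x‖ ^ 2 = ‖x‖ ^ 2 - (‖⟪b p, x⟫_ℂ‖ ^ 2 + ‖⟪b q, x⟫_ℂ‖ ^ 2) := by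
  set y := ⟪b p, x⟫_ℂ • b p + ⟪b q, x⟫_ℂ • b q with hy
  have horth : ⟪pairRemainder b p q x, y⟫_ℂ = 0 := by
    rw [← inner_conj_symm, hy, inner_add_left, inner_smul_left, inner_smul_left,
      inner_left hpq, inner_right hpq]
    simp
  have hnorm_y : ‖y‖ ^ 2 = ‖⟪b p, x⟫_ℂ‖ ^ 2 + ‖⟪b q, x⟫_ℂ‖ ^ 2 := by
    have := norm_add_sq_eq_norm_sq_add_norm_sq_of_inner_eq_zero (⟪b p, x⟫_ℂ • b p)
      (⟪b q, x⟫_ℂ • b q) (𝕜 := ℂ) (by simp [inner_smul_left, inner_smul_right, b.orthonormal.2 hpq])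
    simpa [norm_smul, b.orthonormal.1, ← sq] using this
  have hpyth := norm_add_sq_eq_norm_sq_add_norm_sq_of_inner_eq_zero _ _ horth
  rw [pairRemainder, sub_add_cancel, ← pairRemainder] at hpyth
  linarith

theorem abs_sqrt_two_mul_norm_inner_sub_one_le (hpq : p ≠ q) (hx : ‖x‖ = 1)
    (hsymm : ‖⟪b q, x⟫_ℂ‖ = ‖⟪b p, x⟫_ℂ‖) :
    |√2 * ‖⟪b p, x⟫_ℂ‖ - 1| ≤ ‖pairRemainder b p q x‖ := by
  have hsq := norm_sq (b := b) (x := x) hpq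
  set t := √2 * ‖⟪b p, x⟫_ℂ‖ with ht
  have ht0 : 0 ≤ t := by positivity
  have ht2 : ‖pairRemainder b p q x‖ ^ 2 = (1 - t) * (1 + t) := by
    have : √2 ^ 2 = 2 := Real.sq_sqrt zero_le_two
    rw [hsq, hx, hsymm, ht]
    linear_combination ‖⟪b p, x⟫_ℂ‖ ^ 2 * this
  have hnn := norm_nonneg (pairRemainder b p q x)
  rw [abs_sub_comm, abs_of_nonneg] <;> nlinarith

/-- With only two modes carrying weight, the secular equation reduces to a `2 × 2` matrix whose
diagonal entry is `d p + β`. -/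
theorem abs_eigenvalue_sub_le (hpq : p ≠ q) {lam β : ℝ}
    (hmem : x ∈ perturbedEigenspace b d V lam) (hx : ‖x‖ = 1)
    (hsymm : ‖⟪b q, x⟫_ℂ‖ = ‖⟪b p, x⟫_ℂ‖) (hsmall : ‖pairRemainder b p q x‖ ≤ 1 / 2)
    (hβ : ⟪b p, V (b p)⟫_ℂ = β) :
    |lam - (β + d p)| ≤ ‖⟪b p, V (b q)⟫_ℂ‖ + 2 * (‖V‖ * ‖pairRemainder b p q x‖) := by
  set y := pairRemainder b p q x with hy
  set c := ⟪b p, x⟫_ℂ with hc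
  have hchalf : 1 / 2 ≤ ‖c‖ := by
    have hsq := norm_sq (b := b) (x := x) hpq
    rw [hx, hsymm, ← hy, ← hc] at hsq
    nlinarith [norm_nonneg y, norm_nonneg c]
  have hVx : ⟪b p, V x⟫_ℂ = c * β + ⟪b q, x⟫_ℂ * ⟪b p, V (b q)⟫_ℂ + ⟪b p, V y⟫_ℂ := by
    have hxy : x = c • b p + ⟪b q, x⟫_ℂ • b q + y := by rw [hy, pairRemainder]; abel
    conv_lhs => rw [hxy]
    simp only [map_add, map_smul, inner_add_right, inner_smul_right, hβ]
  have hsecular : ((lam - (β + d p) : ℝ) : ℂ) * c =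
      ⟪b q, x⟫_ℂ * ⟪b p, V (b q)⟫_ℂ + ⟪b p, V y⟫_ℂ := by
    have hp := hmem p
    rw [inner_sub_right, inner_smul_right, hVx] at hp
    push_cast
    linear_combination hp
  have hVy : ‖⟪b p, V y⟫_ℂ‖ ≤ ‖V‖ * ‖y‖ := by
    refine (norm_inner_le_norm _ _).trans ?_
    rw [b.orthonormal.1 p, one_mul]
    exact V.le_opNorm y
  have hbound : |lam - (β + d p)| * ‖c‖ ≤ ‖c‖ * ‖⟪b p, V (b q)⟫_ℂ‖ + ‖V‖ * ‖y‖ := by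
    rw [← Real.norm_eq_abs, ← Complex.norm_real, ← norm_mul, hsecular]
    refine (norm_add_le _ _).trans (add_le_add ?_ hVy)
    rw [norm_mul, hsymm]
  have hnn : 0 ≤ ‖V‖ * ‖y‖ := by positivity
  refine le_of_mul_le_mul_right ?_ (show 0 < ‖c‖ by linarith)
  nlinarith

/-- By AM-GM, `2 |⟪b m, V x⟫| √(w m) ≤ |⟪b m, V x⟫|² + w m`; the right-hand side is summable. -/
theorem summable_norm_inner_and_tsum_le {lam N W : ℝ} {w : ι → ℝ} (hN : 0 < N)
    (hw0 : ∀ m, 0 ≤ w m) (hw : HasSum w W) (hpq : p ≠ q)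
    (hmem : x ∈ perturbedEigenspace b d V lam) (hx : ‖x‖ = 1)
    (hgap : ∀ m, m ≠ p → m ≠ q → N ^ 2 ≤ 4 * (d m - lam) ^ 2 * w m) :
    (Summable fun m => ‖⟪b m, pairRemainder b p q x⟫_ℂ‖) ∧
      ∑' m, ‖⟪b m, pairRemainder b p q x⟫_ℂ‖ ≤ (‖V‖ ^ 2 + W) / N := by
  have hs := ((hasSum_sq_norm_inner b (V x)).add hw).div_const N
  have hle : ∀ m, ‖⟪b m, pairRemainder b p q x⟫_ℂ‖ ≤ (‖⟪b m, V x⟫_ℂ‖ ^ 2 + w m) / N := by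
    intro m
    have hnn : 0 ≤ ‖⟪b m, V x⟫_ℂ‖ ^ 2 + w m := add_nonneg (sq_nonneg _) (hw0 m)
    by_cases hm : m = p ∨ m = q
    · have : ⟪b m, pairRemainder b p q x⟫_ℂ = 0 := by
        rcases hm with rfl | rfl
        exacts [inner_left hpq, inner_right hpq]
      rw [this, norm_zero]
      positivity
    · obtain ⟨hp, hq⟩ := not_or.1 hm
      have hcoef : ‖⟪b m, V x⟫_ℂ‖ ^ 2 = (d m - lam) ^ 2 * ‖⟪b m, x⟫_ℂ‖ ^ 2 := by
        have h := perturbedEigenspace.isDiagonalImage_sub hmem m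
        rw [inner_neg_right] at h
        rw [← norm_neg, h, norm_mul, mul_pow, Complex.norm_real, Real.norm_eq_abs, sq_abs]
      rw [inner_of_ne hp hq, le_div_iff₀ hN]
      refine le_of_sq_le_sq ?_ hnn
      rw [hcoef]
      nlinarith [mul_le_mul_of_nonneg_left (hgap m hp hq) (sq_nonneg ‖⟪b m, x⟫_ℂ‖),
        sq_nonneg ((d m - lam) ^ 2 * ‖⟪b m, x⟫_ℂ‖ ^ 2 - w m)]
  have hsum := hs.summable.of_nonneg_of_le (fun _ => norm_nonneg _) hle
  refine ⟨hsum, (hasSum_le hle hsum.hasSum hs).trans ?_⟩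
  have hVx : ‖V x‖ ≤ ‖V‖ := by simpa [hx] using V.le_opNorm x
  gcongr

end pairRemainder

theorem norm_le_tsum_norm_inner (b : HilbertBasis ι ℂ H) {x : H}
    (hx : Summable fun m => ‖⟪b m, x⟫_ℂ‖) : ‖x‖ ≤ ∑' m, ‖⟪b m, x⟫_ℂ‖ := by
  have hnorm : ∀ m, ‖b.repr x m • b m‖ = ‖⟪b m, x⟫_ℂ‖ := fun m => by
    rw [norm_smul, b.orthonormal.1 m, mul_one, b.repr_apply_apply]
  have h := norm_tsum_le_tsum_norm (f := fun m => b.repr x m • b m) (by simpa only [hnorm] using hx)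
  rwa [(b.hasSum_repr x).tsum_eq, tsum_congr hnorm] at h

theorem exists_unit_vector_inner_eq_conj {S : Submodule ℂ H} {ν : ι → ι}
    (hν : Function.Involutive ν)
    (hS : ∀ x ∈ S, ∃ y ∈ S, ∀ m, ⟪b m, y⟫_ℂ = starRingEnd ℂ ⟪b (ν m), x⟫_ℂ) (hS0 : S ≠ ⊥) :
    ∃ y ∈ S, ‖y‖ = 1 ∧ ∀ m, ⟪b (ν m), y⟫_ℂ = starRingEnd ℂ ⟪b m, y⟫_ℂ := by
  suffices h : ∃ y ∈ S, y ≠ 0 ∧ ∀ m, ⟪b (ν m), y⟫_ℂ = starRingEnd ℂ ⟪b m, y⟫_ℂ by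
    obtain ⟨y, hy, hy0, hconj⟩ := h
    refine ⟨((‖y‖⁻¹ : ℝ) : ℂ) • y, S.smul_mem _ hy, ?_, fun m => ?_⟩
    · rw [norm_smul, Complex.norm_real, norm_inv, norm_norm,
        inv_mul_cancel₀ (norm_ne_zero_iff.2 hy0)]
    · rw [inner_smul_right, inner_smul_right, map_mul, Complex.conj_ofReal, hconj]
  obtain ⟨x, hx, hx0⟩ := S.exists_mem_ne_zero_of_ne_bot hS0
  obtain ⟨x', hx', hconj⟩ := hS x hx
  by_cases hsum : x + x' = 0
  · refine ⟨Complex.I • x, S.smul_mem _ hx, by simpa using hx0, fun m => ?_⟩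
    have h := congrArg (fun v => ⟪b (ν m), v⟫_ℂ) hsum
    simp only [inner_add_right, inner_zero_right, hconj, hν m] at h
    rw [inner_smul_right, inner_smul_right, map_mul, Complex.conj_I]
    linear_combination Complex.I * h
  · refine ⟨x + x', S.add_mem hx hx', hsum, fun m => ?_⟩
    rw [inner_add_right, inner_add_right, hconj, hconj, hν m, map_add, Complex.conj_conj,
      add_comm]

end DiagonalPerturbation

section Indexing

theorem le_ncard_setOf_le_iff {μ : ℕ+ → ℝ} (hmono : Monotone μ) (htend : Tendsto μ atTop atTop)
    (x : ℝ) (k : ℕ+) : (k : ℕ) ≤ {l | μ l ≤ x}.ncard ↔ μ k ≤ x := by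
  have hIic : (Set.Iic k).ncard = k := by
    rw [← Finset.coe_Iic, Set.ncard_coe_finset, show Finset.Iic k = Finset.Icc 1 k by ext; simp,
      PNat.card_Icc, PNat.one_coe, Nat.add_sub_cancel]
  have hfin := finite_setOf_le_of_tendsto_atTop htend x
  constructor
  · intro hk
    by_contra! hlt
    refine hk.not_gt (hIic ▸ Set.ncard_lt_ncard ?_ (Set.finite_Iic k))
    refine (Set.ssubset_iff_of_subset fun l hl => ?_).2 ⟨k, Set.mem_Iic.2 le_rfl, hlt.not_ge⟩
    exact le_of_not_ge fun hkl => (hlt.trans_le (hmono hkl)).not_ge hl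
  · intro hk
    rw [← hIic]
    exact Set.ncard_le_ncard (fun l hl => (hmono hl).trans hk) hfin

theorem ncard_setOf_le_add {μ : ℕ+ → ℝ} (htend : Tendsto μ atTop atTop)
    {T : ℕ → ℝ} (hT : Monotone T) {N r : ℕ}
    (hcard : ∀ n, N ≤ n → {k | T n < μ k ∧ μ k ≤ T (n + 1)}.ncard = r) (t : ℕ) :
    {k | μ k ≤ T (N + t)}.ncard = {k | μ k ≤ T N}.ncard + r * t := by
  induction t with
  | zero => simp
  | succ t ih =>
    have hsplit : {k | μ k ≤ T (N + t + 1)} =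
        {k | μ k ≤ T (N + t)} ∪ {k | T (N + t) < μ k ∧ μ k ≤ T (N + t + 1)} := by
      ext k
      have := hT (N + t).le_succ
      simp only [Set.mem_ofPred_eq, Set.mem_union]
      grind
    have hfin := finite_setOf_le_of_tendsto_atTop htend
    rw [← add_assoc, hsplit, Set.ncard_union_eq
      (Set.disjoint_left.2 fun k h h' => h'.1.not_ge h) (hfin _)
      ((hfin _).subset fun k hk => hk.2), hcard _ (by omega), ih]
    ring

/-- The `n : ℕ` with `j = n` or `j = -1 - n`, so that `(n + 1/2)² = (j + 1/2)²`. -/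
def foldIndex : ℤ → ℕ
  | Int.ofNat n => n
  | Int.negSucc n => n

theorem eq_foldIndex_or (j : ℤ) : j = foldIndex j ∨ j = -1 - (foldIndex j : ℤ) := by
  rcases j with n | n
  exacts [Or.inl rfl, Or.inr (by simp only [foldIndex]; omega)]

theorem exists_equiv_foldIndex (N c : ℕ) :
    ∃ σ : {j : ℤ // ((N + 1 : ℕ) : ℤ) ≤ |j|} ≃ {k : ℕ+ // c + 1 < (k : ℕ)},
      ∀ j : {j : ℤ // ((N + 1 : ℕ) : ℤ) ≤ |j|}, c + 2 * foldIndex j < (σ j : ℕ+) + 2 * N ∧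
        (σ j : ℕ+) + 2 * N ≤ c + 2 * (foldIndex j + 1) := by
  have hnat : ∀ n : ℕ, Equiv.intEquivNat (Int.ofNat n) = 2 * n := fun n => rfl
  have hneg : ∀ n : ℕ, Equiv.intEquivNat (Int.negSucc n) = 2 * n + 1 := fun n => rfl
  have habs : ∀ j : ℤ, ((N + 1 : ℕ) : ℤ) ≤ |j| ↔ 2 * N < Equiv.intEquivNat j := by
    rintro (n | n)
    · rw [hnat, le_abs, Int.ofNat_eq_natCast]; omega
    · rw [hneg, le_abs]; omega
  let τ : {i : ℕ // 2 * N < i} ≃ {k : ℕ+ // c + 1 < (k : ℕ)} :=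
    { toFun := fun i => ⟨⟨c + 1 + (i - 2 * N), by omega⟩, by simp only [PNat.mk_coe]; omega⟩
      invFun := fun k => ⟨(k : ℕ+) - (c + 1) + 2 * N, by omega⟩
      left_inv := fun i => Subtype.ext (by simp only [PNat.mk_coe]; omega)
      right_inv := fun k => Subtype.ext (PNat.eq (by simp only [PNat.mk_coe]; omega)) }
  refine ⟨(Equiv.intEquivNat.subtypeEquiv habs).trans τ, fun j => ?_⟩
  have hfold : Equiv.intEquivNat (j : ℤ) = 2 * foldIndex j ∨
      Equiv.intEquivNat (j : ℤ) = 2 * foldIndex j + 1 := by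
    rcases j with ⟨n | n, _⟩ <;> simp [hnat, hneg, foldIndex, -Int.ofNat_eq_natCast]
  have hj := (habs j).1 j.2
  simp only [Equiv.trans_apply, Equiv.subtypeEquiv_apply, τ, Equiv.coe_fn_mk, PNat.mk_coe]
  omega

theorem le_foldIndex {N : ℕ} {j : ℤ} (hj : ((N + 1 : ℕ) : ℤ) ≤ |j|) : N ≤ foldIndex j := by
  have := eq_foldIndex_or j
  have := le_abs.1 hj
  omega

theorem exists_equiv_of_ncard_eq_two {μ : ℕ+ → ℝ} (hmono : Monotone μ)
    (htend : Tendsto μ atTop atTop) {T : ℕ → ℝ} (hT : Monotone T) {N : ℕ}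
    (hcard : ∀ n, N ≤ n → {k | T n < μ k ∧ μ k ≤ T (n + 1)}.ncard = 2) :
    ∃ (kstar : ℕ) (σ : {j : ℤ // ((N + 1 : ℕ) : ℤ) ≤ |j|} ≃ {k : ℕ+ // kstar < (k : ℕ)}),
      ∀ j : {j : ℤ // ((N + 1 : ℕ) : ℤ) ≤ |j|},
        T (foldIndex j) < μ (σ j) ∧ μ (σ j) ≤ T (foldIndex j + 1) := by
  obtain ⟨σ, hσ⟩ := exists_equiv_foldIndex N {k | μ k ≤ T N}.ncard
  refine ⟨_, σ, fun j => ?_⟩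
  obtain ⟨t, ht⟩ := Nat.exists_eq_add_of_le (le_foldIndex j.2)
  have hcount := ncard_setOf_le_add htend hT hcard
  have hj := hσ j
  rw [← not_le, ← le_ncard_setOf_le_iff hmono htend, ← le_ncard_setOf_le_iff hmono htend, ht,
    add_assoc, hcount, hcount]
  omega

end Indexing

section FreeEigenvalue

/-- The eigenvalue of `(-i d/dθ + c)²` on the mode `e^{imθ}` of the circle. -/
def freeEigenvalue (c : ℝ) (m : ℤ) : ℝ := (m + c) ^ 2

theorem freeEigenvalue_nonneg (c : ℝ) (m : ℤ) : 0 ≤ freeEigenvalue c m := sq_nonneg _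

theorem summable_inv_freeEigenvalue_add_one (c : ℝ) :
    Summable fun m => (freeEigenvalue c m + 1)⁻¹ := by
  have hsum := (Real.summable_one_div_int_add_rpow c 2).2 (by norm_num)
  have hfin : {m : ℤ | (m : ℝ) = -c}.Finite :=
    Set.Subsingleton.finite fun m hm n hn => by exact_mod_cast hm.trans hn.symm
  refine Summable.of_norm_bounded_eventually hsum (hfin.subset fun m hm => ?_)
  by_contra hne
  have hpos : 0 < freeEigenvalue c m :=
    sq_pos_of_ne_zero fun h => hne (eq_neg_of_add_eq_zero_left h)
  refine hm ?_
  change ‖(freeEigenvalue c m + 1)⁻¹‖ ≤ 1 / |(m : ℝ) + c| ^ (2 : ℝ)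
  rw [Real.norm_of_nonneg (by positivity), one_div, Real.rpow_two, sq_abs]
  exact inv_anti₀ hpos (le_add_of_nonneg_right zero_le_one)

theorem freeEigenvalue_half_neg_one_sub (m : ℤ) :
    freeEigenvalue (1 / 2) (-1 - m) = freeEigenvalue (1 / 2) m := by
  unfold freeEigenvalue; push_cast; ring

theorem mul_abs_sub_le_abs_freeEigenvalue_half_sub {n : ℕ} {m : ℤ} {lam : ℝ}
    (hlow : (n : ℝ) ^ 2 < lam) (hupp : lam ≤ ((n : ℝ) + 1) ^ 2) (hm0 : 0 ≤ m) (hm : m ≠ n) :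
    n * |(m : ℝ) - n| ≤ 2 * |freeEigenvalue (1 / 2) m - lam| := by
  have hm0 : (0 : ℝ) ≤ m := by exact_mod_cast hm0
  rw [freeEigenvalue]
  rcases hm.lt_or_gt with h | h
  · have h : (m : ℝ) + 1 ≤ n := by exact_mod_cast h
    rw [abs_of_neg (by linarith), abs_of_neg (by nlinarith)]
    nlinarith
  · have h : (n : ℝ) + 1 ≤ m := by exact_mod_cast h
    rw [abs_of_pos (by linarith), abs_of_pos (by nlinarith)]
    nlinarith

theorem sq_le_mul_inv_sq_add_inv_sq {n : ℕ} {m : ℤ} {lam : ℝ}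
    (hlow : (n : ℝ) ^ 2 < lam) (hupp : lam ≤ ((n : ℝ) + 1) ^ 2) (hm : m ≠ n) (hm' : m ≠ -1 - n) :
    (n : ℝ) ^ 2 ≤ 4 * (freeEigenvalue (1 / 2) m - lam) ^ 2 *
      (1 / ((m : ℝ) + (-n : ℤ)) ^ 2 + 1 / ((m : ℝ) + (1 + n : ℤ)) ^ 2) := by
  wlog hm0 : 0 ≤ m generalizing m
  · have h := this (m := -1 - m) (by omega) (by omega) (by omega)
    rw [freeEigenvalue_half_neg_one_sub, add_comm (1 / _)] at h
    convert! h using 4 <;> (push_cast; ring)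
  have hsq : (n * |(m : ℝ) - n|) ^ 2 ≤ (2 * |freeEigenvalue (1 / 2) m - lam|) ^ 2 := by
    refine pow_le_pow_left₀ (by positivity) ?_ 2
    exact mul_abs_sub_le_abs_freeEigenvalue_half_sub hlow hupp hm0 hm
  rw [mul_pow, mul_pow, sq_abs, sq_abs] at hsq
  have hpos : 0 < ((m : ℝ) - n) ^ 2 := sq_pos_of_ne_zero (sub_ne_zero.2 (by exact_mod_cast hm))
  push_cast
  rw [← sub_eq_add_neg, mul_add, mul_one_div]
  refine le_add_of_le_of_nonneg ?_ (by positivity)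
  rw [le_div_iff₀ hpos]
  linarith

/-- `∑ 1 / m²` over the nonzero integers (the term `m = 0` vanishes, as `1 / 0 = 0`). -/
noncomputable def sumInvSq : ℝ := ∑' m : ℤ, 1 / (m : ℝ) ^ 2

theorem hasSum_inv_sq_shift (k : ℤ) : HasSum (fun m : ℤ => 1 / ((m : ℝ) + k) ^ 2) sumInvSq := by
  have h := (Real.summable_one_div_int_pow (p := 2)).2 one_lt_two
  simpa [Function.comp_def, sumInvSq] using (Equiv.addRight k).hasSum_iff.2 h.hasSum

end FreeEigenvalue

section Cluster

variable {κ : Type*} {H : Type u} [NormedAddCommGroup H] [InnerProductSpace ℂ H]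
  {b : HilbertBasis ℤ ℂ H} {V : H →L[ℂ] H} {e : κ → ℝ} {n : ℕ}

theorem two_mul_le_abs_freeEigenvalue_half_sub {m : ℤ} (hm : m ≠ n) (hm' : m ≠ -1 - n) :
    2 * (n : ℝ) ≤ |freeEigenvalue (1 / 2) m - (n ^ 2 + n + 1 / 2)| := by
  wlog hm0 : 0 ≤ m generalizing m
  · rw [← freeEigenvalue_half_neg_one_sub]
    exact this (by omega) (by omega) (by omega)
  have hm0 : (0 : ℝ) ≤ m := by exact_mod_cast hm0
  rw [freeEigenvalue, le_abs]
  rcases hm.lt_or_gt with h | h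
  · have h : (m : ℝ) + 1 ≤ n := by exact_mod_cast h
    right; nlinarith
  · have h : (n : ℝ) + 1 ≤ m := by exact_mod_cast h
    left; nlinarith

theorem card_le_two_of_eigenvalues_mem_window {u : κ → H} (hon : Orthonormal ℂ u)
    (hu : ∀ i, u i ∈ perturbedEigenspace b (freeEigenvalue (1 / 2)) V (e i))
    (hn : ‖V‖ + 1 < n) (F : Finset κ)
    (hF : ∀ i ∈ F, (n : ℝ) ^ 2 < e i ∧ e i ≤ ((n : ℝ) + 1) ^ 2) : F.card ≤ 2 := by
  refine (perturbedEigenspace.card_le_card hon hu (c := n ^ 2 + n + 1 / 2) (r := n + 1 / 2)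
    (ρ := 2 * n) (by positivity) (by linarith) F (fun i hi => ?_) {(n : ℤ), -1 - (n : ℤ)}
    fun m hm => ?_).trans Finset.card_le_two
  · rw [abs_le]
    constructor <;> nlinarith [hF i hi]
  · simp only [Finset.mem_insert, Finset.mem_singleton, not_or] at hm
    exact two_mul_le_abs_freeEigenvalue_half_sub hm.1 hm.2

theorem two_le_card_of_forall_window_subset {u : HilbertBasis κ ℂ H} (hV : V.IsSymmetric)
    (hu : ∀ i, u i ∈ perturbedEigenspace b (freeEigenvalue (1 / 2)) V (e i))
    (hn : ‖V‖ + 1 < n) (F : Finset κ)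
    (hF : ∀ i, (n : ℝ) ^ 2 < e i → e i ≤ ((n : ℝ) + 1) ^ 2 → i ∈ F) : 2 ≤ F.card := by
  have hpair : ({(n : ℤ), -1 - (n : ℤ)} : Finset ℤ).card = 2 := Finset.card_pair (by omega)
  rw [← hpair]
  refine perturbedEigenspace.card_le_card b.orthonormal
    (perturbedEigenspace.basis_mem_neg hV hu) (c := n ^ 2 + n + 1 / 2) (r := 1 / 4)
    (ρ := n + 1 / 2) (by positivity) (by rw [norm_neg]; linarith) _ (fun m hm => ?_) F
    fun i hi => ?_
  · have hval : freeEigenvalue (1 / 2) m = ((n : ℝ) + 1 / 2) ^ 2 := by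
      simp only [Finset.mem_insert, Finset.mem_singleton] at hm
      rcases hm with rfl | rfl
      · simp [freeEigenvalue]
      · rw [freeEigenvalue_half_neg_one_sub]; simp [freeEigenvalue]
    rw [hval, abs_le]
    constructor <;> nlinarith
  · rw [le_abs]
    rcases le_or_gt (e i) (n ^ 2) with hlow | hlow
    · right; linarith
    · left; linarith [not_le.1 fun hupp => hi (hF i hlow hupp)]

theorem ncard_window_eq_two {u : HilbertBasis κ ℂ H} (hV : V.IsSymmetric)
    (hu : ∀ i, u i ∈ perturbedEigenspace b (freeEigenvalue (1 / 2)) V (e i))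
    (hn : ‖V‖ + 1 < n) : {i | (n : ℝ) ^ 2 < e i ∧ e i ≤ ((n : ℝ) + 1) ^ 2}.ncard = 2 := by
  have hfin : {i | (n : ℝ) ^ 2 < e i ∧ e i ≤ ((n : ℝ) + 1) ^ 2}.Finite :=
    (perturbedEigenspace.finite_setOf_le u.orthonormal hu (freeEigenvalue_nonneg _)
      (finite_setOf_le_of_summable_inv (freeEigenvalue_nonneg _)
        (summable_inv_freeEigenvalue_add_one _)) _).subset fun i hi => hi.2
  rw [Set.ncard_eq_toFinset_card _ hfin]
  exact le_antisymm
    (card_le_two_of_eigenvalues_mem_window u.orthonormal hu hn _ fun i hi => by simpa using hi)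
    (two_le_card_of_forall_window_subset hV hu hn _ fun i hlow hupp => by simp [hlow, hupp])

end Cluster

theorem absolutelyContinuousOnInterval_comp_of_dist_le {X Y : Type*} [PseudoMetricSpace X]
    [PseudoMetricSpace Y] {f : ℝ → X} {g : X → Y} {a b : ℝ}
    (hg : ∀ x y, dist (g x) (g y) ≤ dist x y) (hf : AbsolutelyContinuousOnInterval f a b) :
    AbsolutelyContinuousOnInterval (fun x => g (f x)) a b :=
  squeeze_zero (fun _ => Finset.sum_nonneg fun _ _ => dist_nonneg)
    (fun _ => Finset.sum_le_sum fun _ _ => hg _ _) hf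

theorem integral_eq_sub_of_absolutelyContinuousOnInterval {W w : ℝ → ℂ} {a b : ℝ}
    (hW : AbsolutelyContinuousOnInterval W a b)
    (hd : ∀ᵐ x, x ∈ Set.uIcc a b → HasDerivAt W (w x) x)
    (hw : IntervalIntegrable w volume a b) : ∫ x in a..b, w x = W b - W a := by
  have integral_apply : ∀ L : ℂ →L[ℝ] ℝ, (∀ z, |L z| ≤ ‖z‖) →
      L (∫ x in a..b, w x) = L (W b - W a) := by
    intro L hL
    have hac : AbsolutelyContinuousOnInterval (fun x => L (W x)) a b :=
      absolutelyContinuousOnInterval_comp_of_dist_le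
        (fun x y => by rw [dist_eq_norm, dist_eq_norm, ← map_sub]; exact hL _) hW
    rw [map_sub, ← hac.integral_deriv_eq_sub, ← L.intervalIntegral_comp_comm hw]
    refine intervalIntegral.integral_congr_ae ?_
    filter_upwards [hd] with x hx hx'
    exact (L.hasFDerivAt.comp_hasDerivAt x (hx (Set.uIoc_subset_uIcc hx'))).deriv.symm
  exact Complex.ext (integral_apply Complex.reCLM Complex.abs_re_le_norm)
    (integral_apply Complex.imCLM Complex.abs_im_le_norm)

theorem norm_exp_I_mul_sub_exp_I_mul_le (x y : ℝ) :
    ‖Complex.exp (Complex.I * x) - Complex.exp (Complex.I * y)‖ ≤ ‖x - y‖ := by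
  have hfactor : Complex.exp (Complex.I * x) - Complex.exp (Complex.I * y) =
      Complex.exp (Complex.I * y) * (Complex.exp (Complex.I * ((x - y : ℝ) : ℂ)) - 1) := by
    rw [mul_sub, ← Complex.exp_add, mul_one]
    congr 2
    push_cast
    ring
  rw [hfactor, norm_mul, Complex.norm_exp_I_mul_ofReal, one_mul]
  exact Real.norm_exp_I_mul_ofReal_sub_one_le

namespace CircleMagnetic

section GaugeModes

open scoped ComplexConjugate

theorem integral_arc {E : Type*} [NormedAddCommGroup E] [NormedSpace ℝ E] (f : ℝ → E) :
    ∫ θ, f θ ∂arc = ∫ θ in (0 : ℝ)..(2 * Real.pi), f θ := by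
  rw [intervalIntegral.integral_of_le Real.two_pi_pos.le, arc]

theorem intervalIntegrable_iff_integrable_arc {E : Type*} [NormedAddCommGroup E] {f : ℝ → E} :
    IntervalIntegrable f volume 0 (2 * Real.pi) ↔ Integrable f arc :=
  intervalIntegrable_iff_integrableOn_Ioc_of_le Real.two_pi_pos.le

theorem memLp_arc_of_continuous {f : ℝ → ℂ} (hf : Continuous f) (p : ENNReal) : MemLp f p arc := by
  obtain ⟨C, hC⟩ := (isCompact_Icc (a := (0 : ℝ)) (b := 2 * Real.pi)).exists_bound_of_continuousOn
    hf.continuousOn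
  refine MemLp.of_bound hf.aestronglyMeasurable C ?_
  exact (ae_restrict_iff' measurableSet_Ioc).2
    (ae_of_all _ fun θ hθ => hC θ (Set.Ioc_subset_Icc_self hθ))

theorem memLp_mul_of_memLp_top {ν : Measure ℝ} {p : ENNReal} {f g : ℝ → ℂ} (hf : MemLp f ⊤ ν)
    (hg : MemLp g p ν) : MemLp (fun θ => f θ * g θ) p ν := hg.mul hf

theorem hasH1Deriv_of_absolutelyContinuousOnInterval {f f' : ℝ → ℂ}
    (hac : AbsolutelyContinuousOnInterval f 0 (2 * Real.pi)) (hends : f (2 * Real.pi) = f 0)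
    (hf : MemLp f 2 arc) (hf' : MemLp f' 2 arc)
    (hd : ∀ᵐ θ, θ ∈ Set.uIcc 0 (2 * Real.pi) → HasDerivAt f (f' θ) θ) : HasH1Deriv f f' := by
  refine ⟨hf, hf', fun η hη hper => ?_⟩
  have hη₁ : ContDiff ℝ 1 η := hη.of_le (by exact_mod_cast le_top)
  have hi : Integrable (fun θ => f θ * deriv η θ) arc :=
    HasWeakDeriv.integrable_mul hf (hη₁.continuous_deriv le_rfl)
  have hi' : Integrable (fun θ => f' θ * η θ) arc :=
    HasWeakDeriv.integrable_mul hf' hη₁.continuous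
  have hint := integral_eq_sub_of_absolutelyContinuousOnInterval
    (hac.fun_smul hη₁.contDiffOn.absolutelyContinuousOnInterval)
    (w := fun θ => f' θ * η θ + f θ * deriv η θ) (by
      filter_upwards [hd] with θ hθ hmem
      exact (hθ hmem).mul (hη₁.differentiable one_ne_zero θ).hasDerivAt)
    (intervalIntegrable_iff_integrable_arc.2 (hi'.add hi))
  rw [hends, hper.eq, sub_self, ← integral_arc, integral_add hi' hi] at hint
  linear_combination hint

theorem hasH1Deriv_of_contDiff {f : ℝ → ℂ} (hf : ContDiff ℝ 1 f)
    (hper : Function.Periodic f (2 * Real.pi)) : HasH1Deriv f (deriv f) :=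
  hasH1Deriv_of_absolutelyContinuousOnInterval hf.contDiffOn.absolutelyContinuousOnInterval hper.eq
    (memLp_arc_of_continuous hf.continuous 2)
    (memLp_arc_of_continuous (hf.continuous_deriv le_rfl) 2)
    (ae_of_all _ fun θ _ => (hf.differentiable one_ne_zero θ).hasDerivAt)

/-- A bounded `2π`-periodic magnetic potential `A` whose mean value is congruent to `c`
modulo `ℤ`; the gauge class of `A` is determined by `c`. -/
structure HasFlux (A : ℝ → ℝ) (c : ℝ) : Prop where
  periodic : Function.Periodic A (2 * Real.pi)
  memLp : MemLp A ⊤ arc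
  flux : ∃ k : ℤ, circleMean A = k + c

/-- The phase of the eigenfunction of `-i d/dθ + A` with eigenvalue `m + c`. -/
noncomputable def gaugePhase (A : ℝ → ℝ) (c : ℝ) (m : ℤ) (θ : ℝ) : ℝ :=
  (m + c) * θ - ∫ t in (0 : ℝ)..θ, A t

/-- The normalized eigenfunction of `-i d/dθ + A` with eigenvalue `m + c`. It is `2π`-periodic
when `HasFlux A c`. -/
noncomputable def gaugeMode (A : ℝ → ℝ) (c : ℝ) (m : ℤ) (θ : ℝ) : ℂ :=
  ((√(2 * Real.pi))⁻¹ : ℝ) * Complex.exp (Complex.I * gaugePhase A c m θ)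

theorem norm_gaugeMode (A : ℝ → ℝ) (c : ℝ) (m : ℤ) (θ : ℝ) :
    ‖gaugeMode A c m θ‖ = (√(2 * Real.pi))⁻¹ := by
  rw [gaugeMode, norm_mul, Complex.norm_exp_I_mul_ofReal, mul_one, Complex.norm_real,
    Real.norm_of_nonneg (by positivity)]

theorem gaugeMode_eq_exp_mul (A : ℝ → ℝ) (c : ℝ) (m : ℤ) (θ : ℝ) :
    gaugeMode A c m θ = Complex.exp (Complex.I * m * θ) * gaugeMode A c 0 θ := by
  rw [gaugeMode, gaugeMode, mul_left_comm, ← Complex.exp_add, gaugePhase, gaugePhase]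
  push_cast
  ring_nf

theorem conj_gaugeMode_mul_gaugeMode (A : ℝ → ℝ) (c : ℝ) (m l : ℤ) (θ : ℝ) :
    conj (gaugeMode A c m θ) * gaugeMode A c l θ =
      ((2 * Real.pi : ℝ) : ℂ)⁻¹ * Complex.exp (((l - m : ℤ) : ℂ) * Complex.I * θ) := by
  rw [gaugeMode, gaugeMode, map_mul, Complex.conj_ofReal, ← Complex.exp_conj, map_mul,
    Complex.conj_I, Complex.conj_ofReal, mul_mul_mul_comm, ← Complex.exp_add, ← Complex.ofReal_mul,
    ← mul_inv, Real.mul_self_sqrt Real.two_pi_pos.le, Complex.ofReal_inv, gaugePhase, gaugePhase]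
  push_cast
  ring_nf

theorem integral_exp_int_mul_I (k : ℤ) :
    ∫ θ, Complex.exp (k * Complex.I * (θ : ℝ)) ∂arc =
      if k = 0 then ((2 * Real.pi : ℝ) : ℂ) else 0 := by
  rw [integral_arc]
  split_ifs with hk
  · simp [hk]
  · have hexp : Complex.exp (k * Complex.I * ((2 * Real.pi : ℝ) : ℂ)) = 1 :=
      Complex.exp_eq_one_iff.2 ⟨k, by push_cast; ring⟩
    rw [integral_exp_mul_complex (by simp [hk]), hexp]
    simp

theorem inner_toLp {f g : ℝ → ℂ} (hf : MemLp f 2 arc) (hg : MemLp g 2 arc) :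
    ⟪hf.toLp, hg.toLp⟫_ℂ = ∫ θ, conj (f θ) * g θ ∂arc := by
  rw [L2.inner_def]
  refine integral_congr_ae ?_
  filter_upwards [hf.coeFn_toLp, hg.coeFn_toLp] with θ hfθ hgθ
  rw [hfθ, hgθ, RCLike.inner_apply, mul_comm]

theorem norm_sq_eq_integral (f : Lp ℂ 2 arc) : ‖f‖ ^ 2 = ∫ θ, ‖f θ‖ ^ 2 ∂arc := by
  have hinner : (‖f‖ : ℂ) ^ 2 = ∫ θ, ((‖f θ‖ ^ 2 : ℝ) : ℂ) ∂arc := by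
    refine (inner_self_eq_norm_sq_to_K (𝕜 := ℂ) f).symm.trans ((L2.inner_def f f).trans ?_)
    simp only [inner_self_eq_norm_sq_to_K, Complex.ofReal_pow, Complex.coe_algebraMap]
  rw [integral_complex_ofReal] at hinner
  exact_mod_cast hinner

/-- The `m`-th Fourier coefficient of `f` with respect to the modes `gaugeMode A c`. -/
noncomputable def gaugeCoeff (A : ℝ → ℝ) (c : ℝ) (m : ℤ) (f : ℝ → ℂ) : ℂ :=
  ∫ θ, conj (gaugeMode A c m θ) * f θ ∂arc

theorem gaugeCoeff_const_mul (A : ℝ → ℝ) (c : ℝ) (m : ℤ) (z : ℂ) (f : ℝ → ℂ) :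
    gaugeCoeff A c m (fun θ => z * f θ) = z * gaugeCoeff A c m f := by
  simp only [gaugeCoeff, mul_left_comm _ z, integral_const_mul]

theorem gaugeCoeff_congr (A : ℝ → ℝ) (c : ℝ) (m : ℤ) {f g : ℝ → ℂ} (h : f =ᵐ[arc] g) :
    gaugeCoeff A c m f = gaugeCoeff A c m g := by
  refine integral_congr_ae ?_
  filter_upwards [h] with θ hθ
  rw [hθ]

theorem fourierCoeffOn_conj_gaugeMode_zero_mul (A : ℝ → ℝ) (c : ℝ) (f : ℝ → ℂ) (m : ℤ) :
    fourierCoeffOn Real.two_pi_pos (fun θ => conj (gaugeMode A c 0 θ) * f θ) m =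
      ((2 * Real.pi)⁻¹ : ℝ) * gaugeCoeff A c m f := by
  rw [fourierCoeffOn_eq_integral, ← integral_arc, gaugeCoeff, sub_zero, one_div, Complex.real_smul]
  congr 1
  refine integral_congr_ae (ae_of_all _ fun θ => ?_)
  have hexp : fourier (-m) (θ : AddCircle (2 * Real.pi)) =
      conj (Complex.exp (Complex.I * m * θ)) := by
    rw [fourier_coe_apply, ← Complex.exp_conj]
    congr 1
    simp only [map_mul, Complex.conj_I, Complex.conj_ofReal, map_intCast]
    push_cast
    field_simp
  simp only [smul_eq_mul]
  rw [gaugeMode_eq_exp_mul A c m, map_mul, ← hexp, mul_assoc]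

namespace HasFlux

variable {A : ℝ → ℝ} {c : ℝ}

theorem intervalIntegrable (hA : HasFlux A c) (x y : ℝ) : IntervalIntegrable A volume x y :=
  hA.periodic.intervalIntegrable₀ Real.two_pi_pos.ne'
    (intervalIntegrable_iff_integrable_arc.2 (hA.memLp.integrable le_top)) x y

theorem memLp_ofReal (hA : HasFlux A c) : MemLp (fun θ => (A θ : ℂ)) ⊤ arc := hA.memLp.ofReal

theorem continuous_gaugeMode (hA : HasFlux A c) (m : ℤ) : Continuous (gaugeMode A c m) := by
  have hprim : Continuous fun θ => ∫ t in (0 : ℝ)..θ, A t :=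
    intervalIntegral.continuous_primitive hA.intervalIntegrable 0
  unfold gaugeMode gaugePhase
  fun_prop

theorem memLp_gaugeMode (hA : HasFlux A c) (m : ℤ) : MemLp (gaugeMode A c m) 2 arc :=
  memLp_arc_of_continuous (hA.continuous_gaugeMode m) 2

theorem exists_integral_add_two_pi (hA : HasFlux A c) : ∃ k : ℤ, ∀ θ,
    ∫ t in (0 : ℝ)..(θ + 2 * Real.pi), A t =
      (∫ t in (0 : ℝ)..θ, A t) + 2 * Real.pi * (k + c) := by
  obtain ⟨k, hk⟩ := hA.flux
  have hperiod : ∫ t in (0 : ℝ)..(2 * Real.pi), A t = 2 * Real.pi * (k + c) := by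
    rw [← hk, circleMean]
    field_simp
  refine ⟨k, fun θ => ?_⟩
  rw [← intervalIntegral.integral_add_adjacent_intervals (hA.intervalIntegrable 0 θ)
    (hA.intervalIntegrable θ _), hA.periodic.intervalIntegral_add_eq θ 0, zero_add, hperiod]

theorem periodic_gaugeMode (hA : HasFlux A c) (m : ℤ) :
    Function.Periodic (gaugeMode A c m) (2 * Real.pi) := by
  intro θ
  obtain ⟨k, hk⟩ := hA.exists_integral_add_two_pi
  have hphase : gaugePhase A c m (θ + 2 * Real.pi) =
      gaugePhase A c m θ + (m - k : ℤ) * (2 * Real.pi) := by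
    rw [gaugePhase, gaugePhase, hk]
    push_cast
    ring
  rw [gaugeMode, gaugeMode, hphase, Complex.exp_eq_exp_iff_exists_int.2 ⟨m - k, ?_⟩]
  push_cast
  ring

theorem absolutelyContinuousOnInterval_gaugeMode (hA : HasFlux A c) (m : ℤ) :
    AbsolutelyContinuousOnInterval (gaugeMode A c m) 0 (2 * Real.pi) := by
  have hphase : AbsolutelyContinuousOnInterval (gaugePhase A c m) 0 (2 * Real.pi) := by
    refine AbsolutelyContinuousOnInterval.fun_sub ?_
      ((hA.intervalIntegrable _ _).absolutelyContinuousOnInterval_intervalIntegral (by simp))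
    exact ContDiffOn.absolutelyContinuousOnInterval (by fun_prop)
  refine AbsolutelyContinuousOnInterval.const_smul (M := ℂ) _
    (absolutelyContinuousOnInterval_comp_of_dist_le
      (g := fun x : ℝ => Complex.exp (Complex.I * x)) (fun x y => ?_) hphase)
  rw [dist_eq_norm, dist_eq_norm]
  exact norm_exp_I_mul_sub_exp_I_mul_le x y

theorem ae_hasDerivAt_gaugeMode (hA : HasFlux A c) (m : ℤ) :
    ∀ᵐ θ, θ ∈ Set.uIcc 0 (2 * Real.pi) → HasDerivAt (gaugeMode A c m)
      (Complex.I * ((m : ℂ) + c - A θ) * gaugeMode A c m θ) θ := by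
  filter_upwards [(hA.intervalIntegrable 0 (2 * Real.pi)).ae_hasDerivAt_integral] with θ hθ hmem
  have hphase : HasDerivAt (gaugePhase A c m) (((m : ℝ) + c) * 1 - A θ) θ :=
    ((hasDerivAt_id θ).const_mul _).sub (hθ hmem 0 (by simp))
  convert! ((hphase.ofReal_comp.const_mul Complex.I).cexp).const_mul
    (((√(2 * Real.pi))⁻¹ : ℝ) : ℂ) using 1
  rw [gaugeMode]
  push_cast
  ring

theorem memLp_deriv_gaugeMode (hA : HasFlux A c) (m : ℤ) :
    MemLp (fun θ => Complex.I * ((m : ℂ) + c - A θ) * gaugeMode A c m θ) 2 arc :=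
  memLp_mul_of_memLp_top (((memLp_const ((m : ℂ) + c)).sub hA.memLp_ofReal).const_mul Complex.I)
    (hA.memLp_gaugeMode m)

theorem hasH1Deriv_gaugeMode (hA : HasFlux A c) (m : ℤ) :
    HasH1Deriv (gaugeMode A c m)
      (fun θ => Complex.I * ((m : ℂ) + c - A θ) * gaugeMode A c m θ) :=
  hasH1Deriv_of_absolutelyContinuousOnInterval (hA.absolutelyContinuousOnInterval_gaugeMode m)
    (hA.periodic_gaugeMode m).eq (hA.memLp_gaugeMode m) (hA.memLp_deriv_gaugeMode m)
    (hA.ae_hasDerivAt_gaugeMode m)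

theorem magneticDeriv_gaugeMode (hA : HasFlux A c) (m : ℤ) :
    MagneticDeriv A (gaugeMode A c m) (fun θ => ((m : ℂ) + c) * gaugeMode A c m θ) := by
  refine ⟨_, hA.hasH1Deriv_gaugeMode m, ae_of_all _ fun θ => ?_⟩
  linear_combination ((m : ℂ) + c - A θ) * gaugeMode A c m θ * Complex.I_mul_I

/-- `gaugeMode A c m` as an element of `L²`. -/
noncomputable def modeLp (hA : HasFlux A c) (m : ℤ) : Lp ℂ 2 arc := (hA.memLp_gaugeMode m).toLp

theorem inner_modeLp (hA : HasFlux A c) (m : ℤ) (f : Lp ℂ 2 arc) :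
    ⟪hA.modeLp m, f⟫_ℂ = gaugeCoeff A c m f := by
  conv_lhs => rw [← Lp.toLp_coeFn f (Lp.memLp f)]
  exact inner_toLp _ _

theorem orthonormal_modeLp (hA : HasFlux A c) : Orthonormal ℂ hA.modeLp := by
  rw [orthonormal_iff_ite]
  intro m l
  have hpi : ((2 * Real.pi : ℝ) : ℂ) ≠ 0 := by exact_mod_cast Real.two_pi_pos.ne'
  rw [modeLp, modeLp, inner_toLp]
  simp only [conj_gaugeMode_mul_gaugeMode, integral_const_mul, integral_exp_int_mul_I,
    sub_eq_zero, eq_comm (a := l), mul_ite, mul_zero, inv_mul_cancel₀ hpi]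

theorem orthogonal_span_modeLp (hA : HasFlux A c) :
    (Submodule.span ℂ (Set.range hA.modeLp))ᗮ = ⊥ := by
  rw [eq_bot_iff]
  intro f hf
  have hcoeff : ∀ m, gaugeCoeff A c m f = 0 := fun m => by
    rw [← hA.inner_modeLp]
    exact hf _ (Submodule.subset_span ⟨m, rfl⟩)
  have hnorm : ∀ θ, ‖conj (gaugeMode A c 0 θ) * f θ‖ ^ 2 = (2 * Real.pi)⁻¹ * ‖f θ‖ ^ 2 :=
    fun θ => by
      rw [norm_mul, RCLike.norm_conj, norm_gaugeMode, mul_pow, inv_pow,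
        Real.sq_sqrt Real.two_pi_pos.le]
  have hgmem : MemLp (fun θ => conj (gaugeMode A c 0 θ) * f θ) 2 arc :=
    memLp_mul_of_memLp_top (memLp_arc_of_continuous (hA.continuous_gaugeMode 0) ⊤).star
      (Lp.memLp f)
  have hsum := hasSum_sq_fourierCoeffOn Real.two_pi_pos hgmem
  simp only [fourierCoeffOn_conj_gaugeMode_zero_mul, hcoeff, mul_zero, norm_zero, hnorm,
    sub_zero] at hsum
  rw [← integral_arc, integral_const_mul, ← norm_sq_eq_integral] at hsum
  have hzero := hsum.unique (by simp : HasSum (fun _ : ℤ => (0 : ℝ) ^ 2) 0)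
  simpa [Real.pi_ne_zero] using hzero

/-- The modes `gaugeMode A c m`, `m ∈ ℤ`, as a Hilbert basis of `L²`. -/
noncomputable def basis (hA : HasFlux A c) : HilbertBasis ℤ ℂ (Lp ℂ 2 arc) :=
  HilbertBasis.mkOfOrthogonalEqBot hA.orthonormal_modeLp hA.orthogonal_span_modeLp

theorem basis_apply (hA : HasFlux A c) (m : ℤ) : hA.basis m = hA.modeLp m := by
  rw [basis, HilbertBasis.coe_mkOfOrthogonalEqBot]

theorem inner_basis (hA : HasFlux A c) (m : ℤ) (f : Lp ℂ 2 arc) :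
    ⟪hA.basis m, f⟫_ℂ = gaugeCoeff A c m f := by
  rw [basis_apply, inner_modeLp]

theorem inner_basis_toLp (hA : HasFlux A c) (m : ℤ) {f : ℝ → ℂ} (hf : MemLp f 2 arc) :
    ⟪hA.basis m, hf.toLp⟫_ℂ = gaugeCoeff A c m f := by
  rw [inner_basis, gaugeCoeff_congr A c m hf.coeFn_toLp]

theorem gaugeCoeff_add (hA : HasFlux A c) (m : ℤ) {f g : ℝ → ℂ} (hf : MemLp f 2 arc)
    (hg : MemLp g 2 arc) :
    gaugeCoeff A c m (fun θ => f θ + g θ) = gaugeCoeff A c m f + gaugeCoeff A c m g := by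
  have hmode := (hA.memLp_gaugeMode m).star
  simp only [gaugeCoeff, mul_add]
  exact integral_add (hmode.integrable_mul hf) (hmode.integrable_mul hg)

theorem hasSum_conj_gaugeCoeff_mul (hA : HasFlux A c) {f g : ℝ → ℂ} (hf : MemLp f 2 arc)
    (hg : MemLp g 2 arc) :
    HasSum (fun m => conj (gaugeCoeff A c m f) * gaugeCoeff A c m g)
      (∫ θ, conj (f θ) * g θ ∂arc) := by
  rw [← inner_toLp hf hg]
  convert! hA.basis.hasSum_inner_mul_inner hf.toLp hg.toLp using 2 with m
  rw [← inner_conj_symm, inner_basis_toLp, inner_basis_toLp]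

end HasFlux

theorem hasFlux_zero : HasFlux 0 0 :=
  ⟨fun _ => rfl, MemLp.zero, 0, by simp [circleMean]⟩

theorem conj_gaugeMode_zero (m : ℤ) (θ : ℝ) :
    conj (gaugeMode 0 0 m θ) = ((√(2 * Real.pi))⁻¹ : ℝ) * Complex.exp (-Complex.I * m * θ) := by
  rw [gaugeMode, map_mul, Complex.conj_ofReal, ← Complex.exp_conj, map_mul, Complex.conj_I,
    Complex.conj_ofReal, gaugePhase]
  simp [mul_assoc]

theorem hasDerivAt_conj_gaugeMode_zero (m : ℤ) (θ : ℝ) :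
    HasDerivAt (fun θ => conj (gaugeMode 0 0 m θ))
      (-(Complex.I * m) * conj (gaugeMode 0 0 m θ)) θ := by
  simp only [conj_gaugeMode_zero]
  convert! (((hasDerivAt_id θ).ofReal_comp.const_mul (-Complex.I * m)).cexp).const_mul
    (((√(2 * Real.pi))⁻¹ : ℝ) : ℂ) using 1
  simp only [id, Complex.ofReal_one]
  ring

theorem HasWeakDeriv.gaugeCoeff_zero {f g : ℝ → ℂ} (h : HasWeakDeriv f g) (m : ℤ) :
    gaugeCoeff 0 0 m g = Complex.I * m * gaugeCoeff 0 0 m f := by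
  have hsmooth : ContDiff ℝ (⊤ : ℕ∞) (fun θ => conj (gaugeMode 0 0 m θ)) := by
    simp only [conj_gaugeMode_zero]
    exact contDiff_const.mul (contDiff_const.mul Complex.ofRealCLM.contDiff).cexp
  have hweak := h _ hsmooth fun θ => by rw [hasFlux_zero.periodic_gaugeMode m]
  simp only [(hasDerivAt_conj_gaugeMode_zero m _).deriv, mul_left_comm (f _),
    integral_const_mul] at hweak
  simp only [gaugeCoeff, mul_comm (conj _)]
  linear_combination hweak

-- Test functions are smooth while gauge modes are only Lipschitz, so integration by parts is
-- extended to `H¹` functions by expanding both factors in exponentials.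
theorem HasH1Deriv.integral_conj_mul_eq_neg {f f' h h' : ℝ → ℂ} (hf : HasH1Deriv f f')
    (hh : HasH1Deriv h h') :
    ∫ θ, conj (f θ) * h' θ ∂arc = -∫ θ, conj (f' θ) * h θ ∂arc := by
  refine (hasFlux_zero.hasSum_conj_gaugeCoeff_mul hf.memLp hh.memLp_deriv).unique ?_
  convert! (hasFlux_zero.hasSum_conj_gaugeCoeff_mul hf.memLp_deriv hh.memLp).neg using 2 with m
  rw [hf.weakDeriv.gaugeCoeff_zero, hh.weakDeriv.gaugeCoeff_zero]
  simp only [map_mul, Complex.conj_I, map_intCast]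
  ring

end GaugeModes

section MagneticOperator

open scoped ComplexConjugate

variable {A a : ℝ → ℝ} {c : ℝ}

theorem eq_of_ae_eq_of_periodic {φ ψ : ℝ → ℂ} (hφ : Continuous φ) (hψ : Continuous ψ)
    (hperφ : Function.Periodic φ (2 * Real.pi)) (hperψ : Function.Periodic ψ (2 * Real.pi))
    (h : φ =ᵐ[arc] ψ) : φ = ψ := by
  have heqOn : Set.EqOn φ ψ (Set.Ioc 0 (2 * Real.pi)) :=
    Measure.eqOn_Ioc_of_ae_eq volume h hφ.continuousOn hψ.continuousOn
  have hper : Function.Periodic (fun θ => (φ θ, ψ θ)) (2 * Real.pi) := fun θ => by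
    simp only [hperφ θ, hperψ θ]
  ext θ
  obtain ⟨y, hy, hθ⟩ := hper.exists_mem_Ioc Real.two_pi_pos θ 0
  rw [zero_add] at hy
  rw [Prod.mk.injEq] at hθ
  rw [hθ.1, hθ.2, heqOn hy]

theorem MagneticDeriv.memLp (hA : MemLp A ⊤ arc) {φ ψ : ℝ → ℂ} (h : MagneticDeriv A φ ψ) :
    MemLp ψ 2 arc := by
  obtain ⟨g, hg, hψ⟩ := h
  exact MemLp.ae_eq (EventuallyEq.symm hψ)
    ((hg.memLp_deriv.const_mul _).add (memLp_mul_of_memLp_top hA.ofReal hg.memLp))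

theorem MagneticDeriv.integral_conj_mul_eq (hA : MemLp A ⊤ arc) {φ ψ φ' ψ' : ℝ → ℂ}
    (h : MagneticDeriv A φ ψ) (h' : MagneticDeriv A φ' ψ') :
    ∫ θ, conj (φ' θ) * ψ θ ∂arc = ∫ θ, conj (ψ' θ) * φ θ ∂arc := by
  obtain ⟨g, hg, hψ⟩ := h
  obtain ⟨g', hg', hψ'⟩ := h'
  have hAφ : Integrable (fun θ => conj (φ' θ) * (A θ * φ θ)) arc :=
    hg'.memLp.star.integrable_mul (memLp_mul_of_memLp_top hA.ofReal hg.memLp)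
  have hi : Integrable (fun θ => -Complex.I * (conj (φ' θ) * g θ)) arc :=
    (hg'.memLp.star.integrable_mul hg.memLp_deriv).const_mul _
  have hi' : Integrable (fun θ => Complex.I * (conj (g' θ) * φ θ)) arc :=
    (hg'.memLp_deriv.star.integrable_mul hg.memLp).const_mul _
  calc ∫ θ, conj (φ' θ) * ψ θ ∂arc
      = ∫ θ, -Complex.I * (conj (φ' θ) * g θ) + conj (φ' θ) * (A θ * φ θ) ∂arc := by
        refine integral_congr_ae ?_
        filter_upwards [hψ] with θ hθ
        rw [hθ]
        ring
    _ = ∫ θ, Complex.I * (conj (g' θ) * φ θ) + conj (φ' θ) * (A θ * φ θ) ∂arc := by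
        rw [integral_add hi hAφ, integral_add hi' hAφ, integral_const_mul, integral_const_mul,
          hg'.integral_conj_mul_eq_neg hg, mul_neg, neg_mul, neg_neg]
    _ = ∫ θ, conj (ψ' θ) * φ θ ∂arc := by
        refine integral_congr_ae ?_
        filter_upwards [hψ'] with θ hθ
        rw [hθ]
        simp only [map_add, map_mul, map_neg, Complex.conj_I, Complex.conj_ofReal]
        ring

/-- Multiplication by a bounded real function, as an operator on `L²`. -/
noncomputable def mulOp (ha : MemLp a ⊤ arc) : Lp ℂ 2 arc →L[ℂ] Lp ℂ 2 arc :=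
  (ContinuousLinearMap.mul ℂ ℂ).holderL arc ⊤ 2 2 (ha.ofReal (K := ℂ)).toLp

theorem coeFn_mulOp (ha : MemLp a ⊤ arc) (f : Lp ℂ 2 arc) :
    mulOp ha f =ᵐ[arc] fun θ => a θ * f θ := by
  have hholder := (ContinuousLinearMap.mul ℂ ℂ).coeFn_holder (r := 2) (ha.ofReal (K := ℂ)).toLp f
  filter_upwards [hholder, (ha.ofReal (K := ℂ)).coeFn_toLp] with θ hθ haθ
  rw [mulOp, ContinuousLinearMap.holderL_apply_apply, hθ, haθ]
  rfl

theorem isSymmetric_mulOp (ha : MemLp a ⊤ arc) :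
    (mulOp ha : Lp ℂ 2 arc →ₗ[ℂ] Lp ℂ 2 arc).IsSymmetric := by
  intro f g
  change ⟪mulOp ha f, g⟫_ℂ = ⟪f, mulOp ha g⟫_ℂ
  rw [L2.inner_def, L2.inner_def]
  refine integral_congr_ae ?_
  filter_upwards [coeFn_mulOp ha f, coeFn_mulOp ha g] with θ hf hg
  rw [hf, hg]
  simp only [RCLike.inner_apply, map_mul, Complex.conj_ofReal]
  ring

namespace HasFlux

theorem gaugeCoeff_of_magneticDeriv (hA : HasFlux A c) {φ ψ : ℝ → ℂ} (h : MagneticDeriv A φ ψ)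
    (m : ℤ) : gaugeCoeff A c m ψ = ((m : ℂ) + c) * gaugeCoeff A c m φ := by
  rw [gaugeCoeff, h.integral_conj_mul_eq hA.memLp (hA.magneticDeriv_gaugeMode m), gaugeCoeff,
    ← integral_const_mul]
  simp only [map_mul, map_add, map_intCast, Complex.conj_ofReal, mul_assoc]

theorem integral_conj_mul_of_gaugeCoeff (hA : HasFlux A c) {φ ψ φ' ψ' : ℝ → ℂ}
    (hφ : MemLp φ 2 arc) (hψ : MemLp ψ 2 arc)
    (h : ∀ m : ℤ, gaugeCoeff A c m ψ = ((m : ℂ) + c) * gaugeCoeff A c m φ)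
    (h' : MagneticDeriv A φ' ψ') :
    ∫ θ, conj (ψ' θ) * φ θ ∂arc = ∫ θ, conj (φ' θ) * ψ θ ∂arc := by
  have hφ' : MemLp φ' 2 arc := by
    obtain ⟨g, hg, -⟩ := h'
    exact hg.memLp
  refine (hA.hasSum_conj_gaugeCoeff_mul (h'.memLp hA.memLp) hφ).unique ?_
  convert! hA.hasSum_conj_gaugeCoeff_mul hφ' hψ using 2 with m
  rw [hA.gaugeCoeff_of_magneticDeriv h', h]
  simp only [map_mul, map_add, map_intCast, Complex.conj_ofReal]
  ring

theorem integral_test_mul_of_gaugeCoeff (hA : HasFlux A c) {φ ψ η : ℝ → ℂ} (hφ : MemLp φ 2 arc)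
    (hψ : MemLp ψ 2 arc)
    (h : ∀ m : ℤ, gaugeCoeff A c m ψ = ((m : ℂ) + c) * gaugeCoeff A c m φ)
    (hη : ContDiff ℝ 1 η) (hper : Function.Periodic η (2 * Real.pi)) :
    ∫ θ, (Complex.I * deriv η θ + A θ * η θ) * φ θ ∂arc = ∫ θ, η θ * ψ θ ∂arc := by
  have hconj : HasH1Deriv (fun θ => conj (η θ)) (deriv fun θ => conj (η θ)) :=
    hasH1Deriv_of_contDiff (Complex.conjCLE.contDiff.comp hη) fun θ => by rw [hper θ]
  have hderiv : ∀ θ, deriv (fun θ => conj (η θ)) θ = conj (deriv η θ) := fun θ =>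
    (Complex.conjCLE.hasFDerivAt.comp_hasDerivAt θ
      ((hη.differentiable (by simp)) θ).hasDerivAt).deriv
  have hadjoint := hA.integral_conj_mul_of_gaugeCoeff hφ hψ h ⟨_, hconj, ae_of_all _ fun _ => rfl⟩
  simpa only [hderiv, map_add, map_mul, map_neg, Complex.conj_I, Complex.conj_ofReal,
    Complex.conj_conj, neg_neg] using hadjoint

theorem magneticDeriv_of_gaugeCoeff (hA : HasFlux A c) {φ ψ : ℝ → ℂ} (hφ : MemLp φ 2 arc)
    (hψ : MemLp ψ 2 arc)
    (h : ∀ m : ℤ, gaugeCoeff A c m ψ = ((m : ℂ) + c) * gaugeCoeff A c m φ) :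
    MagneticDeriv A φ ψ := by
  have hAφ := memLp_mul_of_memLp_top hA.memLp_ofReal hφ
  refine ⟨fun θ => Complex.I * (ψ θ - A θ * φ θ), ⟨hφ, (hψ.sub hAφ).const_mul _, ?_⟩,
    ae_of_all _ fun θ => ?_⟩
  · intro η hη hper
    have hη₁ : ContDiff ℝ 1 η := hη.of_le (by exact_mod_cast le_top)
    have hη₂ : MemLp η 2 arc := memLp_arc_of_continuous hη₁.continuous 2
    have hη' : MemLp (deriv η) 2 arc :=
      memLp_arc_of_continuous (hη₁.continuous_deriv le_rfl) 2
    have hiη' : Integrable (fun θ => φ θ * deriv η θ) arc := hφ.integrable_mul hη'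
    have hiψ : Integrable (fun θ => η θ * ψ θ) arc := hη₂.integrable_mul hψ
    have hiAφ : Integrable (fun θ => η θ * (A θ * φ θ)) arc := hη₂.integrable_mul hAφ
    have hsplit : ∫ θ, (Complex.I * deriv η θ + A θ * η θ) * φ θ ∂arc =
        Complex.I * ∫ θ, φ θ * deriv η θ ∂arc + ∫ θ, η θ * (A θ * φ θ) ∂arc := by
      rw [← integral_const_mul, ← integral_add (hiη'.const_mul _) hiAφ]
      congr 1 with θ
      ring
    have hright : ∫ θ, Complex.I * (ψ θ - A θ * φ θ) * η θ ∂arc =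
        Complex.I * (∫ θ, η θ * ψ θ ∂arc - ∫ θ, η θ * (A θ * φ θ) ∂arc) := by
      rw [← integral_sub hiψ hiAφ, ← integral_const_mul]
      congr 1 with θ
      ring
    rw [hright]
    linear_combination -Complex.I * (hA.integral_test_mul_of_gaugeCoeff hφ hψ h hη₁ hper - hsplit)
      + (∫ θ, φ θ * deriv η θ ∂arc) * Complex.I_mul_I
  · linear_combination (ψ θ - A θ * φ θ) * Complex.I_mul_I

theorem inner_basis_mulOp_toLp (hA : HasFlux A c) (ha : MemLp a ⊤ arc) (m : ℤ) {f : ℝ → ℂ}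
    (hf : MemLp f 2 arc) :
    ⟪hA.basis m, mulOp ha hf.toLp⟫_ℂ = gaugeCoeff A c m (fun θ => a θ * f θ) := by
  rw [inner_basis]
  refine gaugeCoeff_congr A c m ?_
  filter_upwards [coeFn_mulOp ha hf.toLp, hf.coeFn_toLp] with θ hmul hθ
  rw [hmul, hθ]

/-- The spectral subspace of `L²` that corresponds to `eigenspace A a z`: in the basis of gauge
modes, `(-i d/dθ + A)² + a` is the diagonal operator `(m + c)²` perturbed by multiplication
by `a`. -/
noncomputable abbrev lpEigenspace (hA : HasFlux A c) (ha : MemLp a ⊤ arc) (z : ℂ) :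
    Submodule ℂ (Lp ℂ 2 arc) :=
  perturbedEigenspace hA.basis (freeEigenvalue c) (mulOp ha) z

theorem toLp_mem_lpEigenspace (hA : HasFlux A c) (ha : MemLp a ⊤ arc) {z : ℂ} {φ : ℝ → ℂ}
    (hφ : MemLp φ 2 arc) (h : MagneticSchrodinger A a φ (fun θ => z * φ θ)) :
    hφ.toLp ∈ hA.lpEigenspace ha z := by
  obtain ⟨ψ, χ, hψ, hχ, hzφ⟩ := h
  intro m
  have haφ : MemLp (fun θ => (a θ : ℂ) * φ θ) 2 arc := memLp_mul_of_memLp_top ha.ofReal hφ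
  have hcoeff := gaugeCoeff_congr A c m hzφ
  rw [gaugeCoeff_const_mul, hA.gaugeCoeff_add m (hχ.memLp hA.memLp) haφ] at hcoeff
  rw [inner_sub_right, inner_smul_right, inner_basis_toLp, inner_basis_mulOp_toLp, hcoeff,
    hA.gaugeCoeff_of_magneticDeriv hχ, hA.gaugeCoeff_of_magneticDeriv hψ, freeEigenvalue]
  push_cast
  ring

theorem exists_gaugeCoeff_eq (hA : HasFlux A c) {z : ℤ → ℂ} (hz : Summable fun m => ‖z m‖ ^ 2) :
    ∃ f : Lp ℂ 2 arc, ∀ m, gaugeCoeff A c m f = z m := by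
  refine ⟨hA.basis.repr.symm ⟨z, memℓp_gen (by simpa using hz)⟩, fun m => ?_⟩
  rw [← hA.inner_basis, ← HilbertBasis.repr_apply_apply, LinearIsometryEquiv.apply_symm_apply]

theorem exists_continuous_of_summable (hA : HasFlux A c) {f : Lp ℂ 2 arc}
    (hf : Summable fun m => ‖gaugeCoeff A c m f‖) :
    ∃ φ : ℝ → ℂ, Continuous φ ∧ Function.Periodic φ (2 * Real.pi) ∧ f =ᵐ[arc] φ ∧
      ∀ θ, HasSum (fun m => gaugeCoeff A c m f * gaugeMode A c m θ) (φ θ) := by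
  let e : ℤ → BoundedContinuousFunction ℝ ℂ := fun m =>
    BoundedContinuousFunction.ofNormedAddCommGroup (gaugeMode A c m) (hA.continuous_gaugeMode m)
      (√(2 * Real.pi))⁻¹ fun θ => (norm_gaugeMode A c m θ).le
  have he : ∀ m, ‖e m‖ ≤ (√(2 * Real.pi))⁻¹ := fun m =>
    BoundedContinuousFunction.norm_ofNormedAddCommGroup_le _ (by positivity) _
  obtain ⟨φ, hφ⟩ : Summable fun m => gaugeCoeff A c m f • e m := by
    refine Summable.of_norm_bounded (hf.mul_right (√(2 * Real.pi))⁻¹) fun m => ?_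
    rw [norm_smul]
    exact mul_le_mul_of_nonneg_left (he m) (norm_nonneg _)
  have hpointwise : ∀ θ, HasSum (fun m => gaugeCoeff A c m f * gaugeMode A c m θ) (φ θ) :=
    fun θ => hφ.mapL (BoundedContinuousFunction.evalCLM ℂ θ)
  have htoLp : BoundedContinuousFunction.toLp (E := ℂ) 2 arc ℂ φ = f := by
    refine (hφ.mapL (BoundedContinuousFunction.toLp (E := ℂ) 2 arc ℂ)).unique ?_
    convert! hA.basis.hasSum_repr f using 2 with m
    rw [map_smul, HilbertBasis.repr_apply_apply, inner_basis, basis_apply, modeLp]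
    rfl
  refine ⟨φ, φ.continuous, fun θ => (hpointwise _).unique ?_, ?_, hpointwise⟩
  · simpa only [hA.periodic_gaugeMode _ θ] using hpointwise θ
  · rw [← htoLp]
    exact BoundedContinuousFunction.coeFn_toLp (E := ℂ) 2 arc ℂ φ

theorem exists_mem_eigenspace (hA : HasFlux A c) (ha : MemLp a ⊤ arc) {z : ℂ} {f : Lp ℂ 2 arc}
    (hf : f ∈ hA.lpEigenspace ha z) :
    ∃ φ ∈ eigenspace A a z, f =ᵐ[arc] φ ∧
      ∀ θ, HasSum (fun m => gaugeCoeff A c m f * gaugeMode A c m θ) (φ θ) := by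
  have hdiag : IsDiagonalImage hA.basis (freeEigenvalue c) f (z • f - mulOp ha f) := hf
  have hsum := hdiag.summable_norm_inner (freeEigenvalue_nonneg c)
    (summable_inv_freeEigenvalue_add_one c)
  have hsum' := hdiag.summable_abs_mul_sq_norm_inner hsum
  simp only [inner_basis] at hsum hsum'
  obtain ⟨ψ, hψ⟩ := hA.exists_gaugeCoeff_eq (z := fun m => ((m : ℂ) + c) * gaugeCoeff A c m f) (by
    refine hsum'.congr fun m => ?_
    rw [norm_mul, mul_pow, freeEigenvalue, abs_sq, ← Complex.ofReal_intCast, ← Complex.ofReal_add,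
      Complex.norm_real, Real.norm_eq_abs, sq_abs])
  obtain ⟨φ, hcont, hper, hae, hpointwise⟩ := hA.exists_continuous_of_summable hsum
  refine ⟨φ, ⟨hcont, hper, ψ, (z • f - mulOp ha f : Lp ℂ 2 arc),
    hA.magneticDeriv_of_gaugeCoeff (memLp_arc_of_continuous hcont 2) (Lp.memLp _) fun m => ?_,
    hA.magneticDeriv_of_gaugeCoeff (Lp.memLp _) (Lp.memLp _) fun m => ?_, ?_⟩, hae,
    hpointwise⟩
  · rw [hψ, gaugeCoeff_congr A c m hae]
  · rw [hψ, ← hA.inner_basis, hdiag m, hA.inner_basis, freeEigenvalue]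
    push_cast
    ring
  · filter_upwards [hae, Lp.coeFn_sub (z • f) (mulOp ha f), Lp.coeFn_smul z f, coeFn_mulOp ha f]
      with θ hθ hsub hsmul hmul
    rw [hsub, Pi.sub_apply, hsmul, hmul, Pi.smul_apply, smul_eq_mul, hθ]
    ring

/-- The class in `L²` of an eigenfunction, as a linear map between eigenspaces. -/
noncomputable def eigenspaceToLp (hA : HasFlux A c) (ha : MemLp a ⊤ arc) (z : ℂ) :
    eigenspace A a z →ₗ[ℂ] hA.lpEigenspace ha z where
  toFun φ := ⟨(memLp_arc_of_continuous φ.2.1 2).toLp, hA.toLp_mem_lpEigenspace ha _ φ.2.2.2⟩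
  map_add' _ _ := rfl
  map_smul' _ _ := rfl

theorem bijective_eigenspaceToLp (hA : HasFlux A c) (ha : MemLp a ⊤ arc) (z : ℂ) :
    Function.Bijective (hA.eigenspaceToLp ha z) := by
  refine ⟨fun φ ψ h => ?_, fun f => ?_⟩
  · have hae := (MemLp.toLp_eq_toLp_iff (memLp_arc_of_continuous φ.2.1 2)
      (memLp_arc_of_continuous ψ.2.1 2)).1 (congrArg Subtype.val h)
    exact Subtype.ext (eq_of_ae_eq_of_periodic φ.2.1 ψ.2.1 φ.2.2.1 ψ.2.2.1 hae)
  · obtain ⟨φ, hφ, hae, -⟩ := hA.exists_mem_eigenspace ha f.2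
    exact ⟨⟨φ, hφ⟩, Subtype.ext (Lp.ext
      ((memLp_arc_of_continuous hφ.1 2).coeFn_toLp.trans hae.symm))⟩

theorem exists_isEigenvalueSequence (hA : HasFlux A c) (ha : MemLp a ⊤ arc) :
    ∃ (u : HilbertBasis ℕ+ ℂ (Lp ℂ 2 arc)) (μ : ℕ+ → ℝ), IsEigenvalueSequence A a μ ∧
      ∀ k, u k ∈ hA.lpEigenspace ha (μ k) := by
  obtain ⟨u, μ, hmono, htend, hu⟩ := perturbedEigenspace.exists_sorted_hilbertBasis_mem hA.basis
    (isSymmetric_mulOp ha) (freeEigenvalue_nonneg c) (summable_inv_freeEigenvalue_add_one c)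
  have hmult : ∀ z : ℂ, FiniteDimensional ℂ (hA.lpEigenspace ha z) ∧
      {k | (μ k : ℂ) = z}.ncard = Module.finrank ℂ (hA.lpEigenspace ha z) := fun z =>
    perturbedEigenspace.finiteDimensional_and_ncard_eq_finrank (isSymmetric_mulOp ha) u hu
      ((finite_setOf_le_of_tendsto_atTop htend z.re).subset fun k hk => by
        rw [Set.mem_ofPred_eq, ← show (μ k : ℂ) = z from hk, Complex.ofReal_re])
  let e (z : ℂ) := LinearEquiv.ofBijective _ (hA.bijective_eigenspaceToLp ha z)
  refine ⟨u, μ, ⟨hmono, htend, fun z => ?_, fun z => (hmult z).2.trans (e z).finrank_eq.symm⟩, hu⟩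
  have := (hmult z).1
  exact (e z).symm.finiteDimensional

theorem exists_eigenbasis_of_isEigenvalueSequence (hA : HasFlux A c) (ha : MemLp a ⊤ arc)
    {μ : ℕ+ → ℝ} (hμ : IsEigenvalueSequence A a μ) :
    ∃ u : HilbertBasis ℕ+ ℂ (Lp ℂ 2 arc), ∀ k, u k ∈ hA.lpEigenspace ha (μ k) := by
  obtain ⟨u, ν, hν, hu⟩ := hA.exists_isEigenvalueSequence ha
  have finite_fiber : ∀ {ρ : ℕ+ → ℝ}, IsEigenvalueSequence A a ρ →
      ∀ x : ℝ, Finite {k // ρ k = x} := fun hρ x =>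
    ((finite_setOf_le_of_tendsto_atTop hρ.tendsto x).subset fun _ hk => le_of_eq hk).to_subtype
  have hfiber : ∀ x : ℝ, Nonempty ({k // μ k = x} ≃ {k // ν k = x}) := by
    intro x
    have := finite_fiber hμ x
    have := finite_fiber hν x
    have hcard := (hμ.count x).trans (hν.count x).symm
    simp only [Complex.ofReal_inj] at hcard
    exact Finite.card_eq.1 hcard
  obtain ⟨v, hv⟩ := exists_hilbertBasis_comp_equiv u (Equiv.ofFiberEquiv fun x => (hfiber x).some)
  refine ⟨v, fun k => ?_⟩
  rw [hv, ← Equiv.ofFiberEquiv_map (fun x => (hfiber x).some) k]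
  exact hu _

end HasFlux

end MagneticOperator

section MatrixElements

variable {A a : ℝ → ℝ} {c : ℝ}

theorem norm_gaugeCoeff_le (A : ℝ → ℝ) (c : ℝ) (m : ℤ) (f : ℝ → ℂ) :
    ‖gaugeCoeff A c m f‖ ≤ (√(2 * Real.pi))⁻¹ * ∫ θ, ‖f θ‖ ∂arc := by
  rw [gaugeCoeff, ← integral_const_mul]
  refine (norm_integral_le_integral_norm _).trans_eq ?_
  simp only [norm_mul, RCLike.norm_conj, norm_gaugeMode]

theorem HasWeakDeriv.abs_mul_norm_gaugeCoeff_zero_le {f g : ℝ → ℂ} (h : HasWeakDeriv f g) (m : ℤ) :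
    |(m : ℝ)| * ‖gaugeCoeff 0 0 m f‖ ≤ (√(2 * Real.pi))⁻¹ * ∫ θ, ‖g θ‖ ∂arc := by
  calc |(m : ℝ)| * ‖gaugeCoeff 0 0 m f‖ = ‖gaugeCoeff 0 0 m g‖ := by
        rw [h.gaugeCoeff_zero, norm_mul, norm_mul, Complex.norm_I, one_mul, Complex.norm_intCast]
    _ ≤ _ := norm_gaugeCoeff_le 0 0 m g

namespace HasFlux

theorem inner_basis_mulOp_basis (hA : HasFlux A c) (ha : MemLp a ⊤ arc) (m l : ℤ) :
    ⟪hA.basis m, mulOp ha (hA.basis l)⟫_ℂ =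
      ((√(2 * Real.pi))⁻¹ : ℝ) * gaugeCoeff 0 0 (m - l) (fun θ => a θ) := by
  rw [basis_apply hA l, modeLp, inner_basis_mulOp_toLp, gaugeCoeff, gaugeCoeff,
    ← integral_const_mul]
  congr 1 with θ
  have hsqrt : (((√(2 * Real.pi))⁻¹ : ℝ) : ℂ) * ((√(2 * Real.pi))⁻¹ : ℝ) =
      ((2 * Real.pi : ℝ) : ℂ)⁻¹ := by
    rw [← Complex.ofReal_mul, ← mul_inv, Real.mul_self_sqrt Real.two_pi_pos.le, Complex.ofReal_inv]
  have hexp : Complex.exp (((l - m : ℤ) : ℂ) * Complex.I * θ) =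
      Complex.exp (-Complex.I * ((m - l : ℤ) : ℂ) * θ) := by
    congr 1
    push_cast
    ring
  rw [mul_left_comm, conj_gaugeMode_mul_gaugeMode, conj_gaugeMode_zero, hexp, ← hsqrt]
  ring

theorem inner_basis_mulOp_basis_self (hA : HasFlux A c) (ha : MemLp a ⊤ arc) (m : ℤ) :
    ⟪hA.basis m, mulOp ha (hA.basis m)⟫_ℂ = circleMean a := by
  have hcoeff : gaugeCoeff 0 0 0 (fun θ => a θ) =
      ((√(2 * Real.pi))⁻¹ : ℝ) * ((∫ θ, a θ ∂arc : ℝ) : ℂ) := by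
    simp only [gaugeCoeff, conj_gaugeMode_zero, Int.cast_zero, mul_zero, zero_mul, Complex.exp_zero,
      mul_one, integral_const_mul]
    rw [integral_complex_ofReal]
  rw [inner_basis_mulOp_basis, sub_self, hcoeff, circleMean, ← integral_arc, ← mul_assoc,
    ← Complex.ofReal_mul, ← mul_inv, Real.mul_self_sqrt Real.two_pi_pos.le, ← Complex.ofReal_mul,
    one_div]

theorem abs_sub_mul_norm_inner_basis_mulOp_basis_le (hA : HasFlux A c) (ha : MemLp a ⊤ arc)
    {g : ℝ → ℂ} (hg : HasWeakDeriv (fun θ => a θ) g) (m l : ℤ) :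
    |(m : ℝ) - l| * ‖⟪hA.basis m, mulOp ha (hA.basis l)⟫_ℂ‖ ≤
      (2 * Real.pi)⁻¹ * ∫ θ, ‖g θ‖ ∂arc := by
  have hcoeff := hg.abs_mul_norm_gaugeCoeff_zero_le (m - l)
  rw [Int.cast_sub] at hcoeff
  have hpos : 0 ≤ (√(2 * Real.pi))⁻¹ := by positivity
  have hsqrt : (2 * Real.pi)⁻¹ = (√(2 * Real.pi))⁻¹ * (√(2 * Real.pi))⁻¹ := by
    rw [← mul_inv, Real.mul_self_sqrt Real.two_pi_pos.le]
  rw [inner_basis_mulOp_basis, norm_mul, Complex.norm_real, Real.norm_of_nonneg hpos,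
    mul_left_comm, hsqrt, mul_assoc]
  exact mul_le_mul_of_nonneg_left hcoeff hpos

end HasFlux

end MatrixElements

section ConjugationSymmetry

open scoped ComplexConjugate

variable {A a : ℝ → ℝ} {c : ℝ}

theorem conj_gaugeMode_mul_gaugeMode_mul_gaugeMode (A : ℝ → ℝ) (c : ℝ) (m p q : ℤ) (θ : ℝ) :
    conj (gaugeMode A c m θ) * (2 * Real.pi * (gaugeMode A c p θ * gaugeMode A c q θ)) =
      gaugeMode A c (p + q - m) θ := by
  have hpi : (Real.pi : ℂ) ≠ 0 := by exact_mod_cast Real.pi_ne_zero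
  have hexp : Complex.exp (((p - m : ℤ) : ℂ) * Complex.I * θ) * Complex.exp (Complex.I * q * θ) =
      Complex.exp (Complex.I * ((p + q - m : ℤ) : ℂ) * θ) := by
    rw [← Complex.exp_add]
    congr 1
    push_cast
    ring
  rw [mul_left_comm, ← mul_assoc (conj _), conj_gaugeMode_mul_gaugeMode,
    gaugeMode_eq_exp_mul A c q, gaugeMode_eq_exp_mul A c (p + q - m), ← hexp]
  push_cast
  field_simp

theorem gaugeCoeff_gaugeMode_mul_conj (A : ℝ → ℝ) (c : ℝ) (m p q : ℤ) (f : ℝ → ℂ) :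
    gaugeCoeff A c m
        (fun θ => 2 * Real.pi * (gaugeMode A c p θ * gaugeMode A c q θ) * conj (f θ)) =
      conj (gaugeCoeff A c (p + q - m) f) := by
  rw [gaugeCoeff, gaugeCoeff, ← integral_conj]
  congr 1 with θ
  rw [← mul_assoc, conj_gaugeMode_mul_gaugeMode_mul_gaugeMode, map_mul, Complex.conj_conj]

namespace HasFlux

theorem exists_inner_basis_eq_conj_mem_lpEigenspace (hA : HasFlux A (1 / 2)) (ha : MemLp a ⊤ arc)
    {lam : ℝ} {f : Lp ℂ 2 arc} (hf : f ∈ hA.lpEigenspace ha lam) :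
    ∃ g ∈ hA.lpEigenspace ha lam,
      ∀ m, ⟪hA.basis m, g⟫_ℂ = conj ⟪hA.basis (-1 - m), f⟫_ℂ := by
  let γ : ℝ → ℂ := fun θ =>
    2 * Real.pi * (gaugeMode A (1 / 2) 0 θ * gaugeMode A (1 / 2) (-1) θ)
  have hγ : Continuous γ :=
    continuous_const.mul ((hA.continuous_gaugeMode 0).mul (hA.continuous_gaugeMode (-1)))
  have hg : MemLp (fun θ => γ θ * conj (f θ)) 2 arc :=
    memLp_mul_of_memLp_top (memLp_arc_of_continuous hγ ⊤) (Lp.memLp f).star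
  have hcoeff : ∀ m (h : ℝ → ℂ), gaugeCoeff A (1 / 2) m (fun θ => γ θ * conj (h θ)) =
      conj (gaugeCoeff A (1 / 2) (-1 - m) h) := fun m h => by
    rw [gaugeCoeff_gaugeMode_mul_conj, zero_add]
  have hinner : ∀ m, ⟪hA.basis m, hg.toLp⟫_ℂ = conj ⟪hA.basis (-1 - m), f⟫_ℂ := fun m => by
    rw [inner_basis_toLp, inner_basis, hcoeff]
  have hmul : ∀ m, ⟪hA.basis m, mulOp ha hg.toLp⟫_ℂ = conj ⟪hA.basis (-1 - m), mulOp ha f⟫_ℂ := by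
    intro m
    rw [inner_basis_mulOp_toLp, inner_basis, ← hcoeff]
    refine gaugeCoeff_congr A _ m ?_
    filter_upwards [coeFn_mulOp ha f] with θ hθ
    rw [hθ, map_mul, Complex.conj_ofReal]
    ring
  refine ⟨hg.toLp, fun m => ?_, hinner⟩
  have hreflected := congrArg conj (hf (-1 - m))
  rw [inner_sub_right, inner_smul_right, map_sub, map_mul, map_mul, Complex.conj_ofReal,
    Complex.conj_ofReal, freeEigenvalue_half_neg_one_sub] at hreflected
  rw [inner_sub_right, inner_smul_right, hinner, hmul]
  exact hreflected

theorem exists_unit_mem_lpEigenspace_inner_eq_conj (hA : HasFlux A (1 / 2)) (ha : MemLp a ⊤ arc)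
    {lam : ℝ} (hlam : hA.lpEigenspace ha lam ≠ ⊥) :
    ∃ f ∈ hA.lpEigenspace ha lam, ‖f‖ = 1 ∧
      ∀ m, ⟪hA.basis (-1 - m), f⟫_ℂ = conj ⟪hA.basis m, f⟫_ℂ :=
  exists_unit_vector_inner_eq_conj (fun m => sub_sub_cancel (-1) m)
    (fun _ hf => hA.exists_inner_basis_eq_conj_mem_lpEigenspace ha hf) hlam

end HasFlux

theorem mul_exp_add_conj_mul_exp (z : ℂ) (x : ℝ) :
    z * Complex.exp (Complex.I * x) + conj z * Complex.exp (Complex.I * (-x : ℝ)) =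
      ((2 * (‖z‖ * Real.cos (x + z.arg)) : ℝ) : ℂ) := by
  have hpolar : z * Complex.exp (Complex.I * x) =
      ‖z‖ * Complex.exp ((x + z.arg : ℝ) * Complex.I) := by
    conv_lhs => rw [← Complex.norm_mul_exp_arg_mul_I z]
    rw [mul_assoc, ← Complex.exp_add]
    push_cast
    ring_nf
  have hconj : conj z * Complex.exp (Complex.I * (-x : ℝ)) =
      conj (z * Complex.exp (Complex.I * x)) := by
    rw [map_mul, ← Complex.exp_conj, map_mul, Complex.conj_I, Complex.conj_ofReal]
    push_cast
    ring_nf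
  rw [hconj, Complex.add_conj, hpolar, Complex.re_ofReal_mul, Complex.exp_ofReal_mul_I_re]

/-- The modulating factor `π^{-1/2} e^{-i ∫₀^θ A}` of the asymptotic expansion of the
eigenfunctions. -/
noncomputable def gaugeFactor (A : ℝ → ℝ) (θ : ℝ) : ℂ :=
  ((1 / √Real.pi : ℝ) : ℂ) * Complex.exp (-Complex.I * ((∫ t in (0 : ℝ)..θ, A t : ℝ) : ℂ))

theorem norm_gaugeFactor (A : ℝ → ℝ) (θ : ℝ) : ‖gaugeFactor A θ‖ = 1 / √Real.pi := by
  rw [gaugeFactor, norm_mul, Complex.norm_real, Real.norm_of_nonneg (by positivity), neg_mul_comm,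
    ← Complex.ofReal_neg, Complex.norm_exp_I_mul_ofReal, mul_one]

theorem gaugeFactor_ne_zero (A : ℝ → ℝ) (θ : ℝ) : gaugeFactor A θ ≠ 0 := by
  rw [← norm_pos_iff, norm_gaugeFactor]
  positivity

theorem two_mul_gaugeMode (A : ℝ → ℝ) (c : ℝ) (m : ℤ) (θ : ℝ) :
    2 * gaugeMode A c m θ =
      √2 * gaugeFactor A θ * Complex.exp (Complex.I * ((m + c) * θ : ℝ)) := by
  have hsqrt : 2 * (√(2 * Real.pi))⁻¹ = √2 * (1 / √Real.pi) := by
    rw [Real.sqrt_mul zero_le_two, mul_inv, ← mul_assoc, ← div_eq_mul_inv 2, Real.div_sqrt, one_div]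
  have hexp : Complex.exp (Complex.I * gaugePhase A c m θ) =
      Complex.exp (-Complex.I * ((∫ t in (0 : ℝ)..θ, A t : ℝ) : ℂ)) *
        Complex.exp (Complex.I * ((m + c) * θ : ℝ)) := by
    rw [← Complex.exp_add, gaugePhase]
    congr 1
    push_cast
    ring
  rw [gaugeMode, gaugeFactor, hexp, ← mul_assoc, ← mul_assoc, ← mul_assoc, ← Complex.ofReal_mul √2,
    ← hsqrt, Complex.ofReal_mul 2, Complex.ofReal_ofNat]

theorem mul_gaugeMode_add_conj_mul_gaugeMode (A : ℝ → ℝ) (n : ℤ) (z : ℂ) (θ : ℝ) :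
    z * gaugeMode A (1 / 2) n θ + conj z * gaugeMode A (1 / 2) (-1 - n) θ =
      gaugeFactor A θ * ((√2 * ‖z‖ * Real.cos ((n + 1 / 2) * θ + z.arg) : ℝ) : ℂ) := by
  have hreflect : (((-1 - n : ℤ) : ℝ) + 1 / 2) * θ = -((n + 1 / 2) * θ) := by
    push_cast
    ring
  have hn := two_mul_gaugeMode A (1 / 2) n θ
  have hn' := two_mul_gaugeMode A (1 / 2) (-1 - n) θ
  have hcos := mul_exp_add_conj_mul_exp z ((n + 1 / 2) * θ)
  rw [hreflect] at hn'
  generalize ((n : ℝ) + 1 / 2) * θ = x at *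
  simp only [Complex.ofReal_mul, Complex.ofReal_ofNat] at hcos ⊢
  linear_combination z / 2 * hn + conj z / 2 * hn' + √2 * gaugeFactor A θ / 2 * hcos

theorem exists_cos_mul_add_arg_eq {x : ℝ} (hx : 1 ≤ x) (z : ℂ) :
    ∃ ϑ ∈ Set.Icc 0 (2 * Real.pi), ∀ θ, Real.cos (x * θ + z.arg) = Real.cos (x * (θ - ϑ)) := by
  have hx0 : x ≠ 0 := by linarith
  have mem_Icc : ∀ α, 0 ≤ α → α ≤ 2 * Real.pi → α / x ∈ Set.Icc 0 (2 * Real.pi) := fun α h0 h1 =>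
    ⟨by positivity, (div_le_self h0 hx).trans h1⟩
  have hpi := Real.pi_pos
  rcases le_total z.arg 0 with h | h
  · refine ⟨-z.arg / x, mem_Icc _ (by linarith) (by linarith [z.neg_pi_lt_arg]), fun θ => ?_⟩
    rw [mul_sub, mul_div_cancel₀ _ hx0, sub_neg_eq_add]
  · refine ⟨(2 * Real.pi - z.arg) / x, mem_Icc _ (by linarith [z.arg_le_pi]) (by linarith),
      fun θ => ?_⟩
    rw [mul_sub, mul_div_cancel₀ _ hx0, ← Real.cos_sub_two_pi]
    ring_nf

end ConjugationSymmetry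

section Asymptotics

variable {A a : ℝ → ℝ} {c : ℝ}

/-- `lam` is an eigenvalue of the magnetic Schrödinger operator with normalized eigenfunction `φ`,
and both obey the asymptotic formulas with index `j`, phase `ϑ`, remainder `R` and error
constant `C`. -/
structure EigenpairExpansion (A a : ℝ → ℝ) (C lam : ℝ) (j : ℤ) (ϑ : ℝ) (φ R : ℝ → ℂ) :
    Prop where
  abs_eigenvalue_sub_le : |lam - (circleMean a + ((j : ℝ) + 1 / 2) ^ 2)| ≤ C / |(j : ℝ)|
  phase_mem : ϑ ∈ Set.Icc 0 (2 * Real.pi)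
  mem_eigenspace : φ ∈ eigenspace A a lam
  integral_norm_sq : ∫ θ in (0 : ℝ)..(2 * Real.pi), ‖φ θ‖ ^ 2 = 1
  eq_gaugeFactor_mul : ∀ θ,
    φ θ = gaugeFactor A θ * ((Real.cos (((j : ℝ) + 1 / 2) * (θ - ϑ)) : ℂ) + R θ)
  norm_remainder_le : ∀ θ, ‖R θ‖ ≤ C / |(j : ℝ)|

theorem EigenpairExpansion.of_foldIndex {C lam ϑ : ℝ} {j : ℤ} {φ R : ℝ → ℂ}
    (h : EigenpairExpansion A a C lam (foldIndex j) ϑ φ R) (hj : 0 < foldIndex j) :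
    EigenpairExpansion A a (2 * C) lam j ϑ φ R := by
  have hcases := eq_foldIndex_or j
  set n := foldIndex j
  have hn : (0 : ℝ) < n := by exact_mod_cast hj
  have hC : 0 ≤ C := by
    have := (abs_nonneg _).trans h.abs_eigenvalue_sub_le
    rwa [Int.cast_natCast, Nat.abs_cast, le_div_iff₀ hn, zero_mul] at this
  have hle : C / |((n : ℤ) : ℝ)| ≤ 2 * C / |(j : ℝ)| := by
    have hj0 : 0 < |(j : ℝ)| := abs_pos.2 (by exact_mod_cast (by omega : j ≠ 0))
    have hjn : |(j : ℝ)| ≤ 2 * n := by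
      exact_mod_cast (abs_le.2 (by omega) : |j| ≤ 2 * (n : ℤ))
    rw [Int.cast_natCast, Nat.abs_cast, div_le_div_iff₀ hn hj0]
    linarith [mul_le_mul_of_nonneg_left hjn hC]
  have hreflect : (j : ℝ) + 1 / 2 = ((n : ℤ) : ℝ) + 1 / 2 ∨
      (j : ℝ) + 1 / 2 = -(((n : ℤ) : ℝ) + 1 / 2) := by
    refine hcases.imp (fun hj => by rw [hj]) fun hj => ?_
    rw [hj]
    push_cast
    ring
  have hsq : ((j : ℝ) + 1 / 2) ^ 2 = (((n : ℤ) : ℝ) + 1 / 2) ^ 2 :=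
    sq_eq_sq_iff_eq_or_eq_neg.2 hreflect
  have hcos : ∀ x, Real.cos (((j : ℝ) + 1 / 2) * x) = Real.cos ((((n : ℤ) : ℝ) + 1 / 2) * x) := by
    intro x
    rcases hreflect with hj | hj
    · rw [hj]
    · rw [hj, neg_mul, Real.cos_neg]
  exact ⟨hsq ▸ h.abs_eigenvalue_sub_le.trans hle, h.phase_mem, h.mem_eigenspace,
    h.integral_norm_sq, fun θ => hcos _ ▸ h.eq_gaugeFactor_mul θ,
    fun θ => (h.norm_remainder_le θ).trans hle⟩

/-- The constant `K` such that a normalized eigenfunction with eigenvalue in `(n², (n + 1)²]` lies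
within `K / n` of the span of the modes `n` and `-1 - n`. -/
noncomputable def clusterConst (ha : MemLp a ⊤ arc) : ℝ :=
  ‖mulOp ha‖ ^ 2 + (sumInvSq + sumInvSq)

theorem norm_inv_gaugeFactor_mul_sub_le {θ t x τ : ℝ} {w : ℂ} (hx : |x| ≤ 1) (ht : |t - 1| ≤ τ)
    (hw : ‖w - gaugeFactor A θ * ((t * x : ℝ) : ℂ)‖ ≤ (√(2 * Real.pi))⁻¹ * τ) :
    ‖(gaugeFactor A θ)⁻¹ * w - x‖ ≤ 2 * τ := by
  have hτ : 0 ≤ τ := (abs_nonneg _).trans ht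
  have hsqrt : √Real.pi * (√(2 * Real.pi))⁻¹ ≤ 1 := by
    rw [← div_eq_mul_inv]
    exact div_le_one_of_le₀ (Real.sqrt_le_sqrt (by linarith [Real.pi_pos])) (Real.sqrt_nonneg _)
  have hsplit : (gaugeFactor A θ)⁻¹ * w - x =
      ((t - 1) * x : ℝ) + (gaugeFactor A θ)⁻¹ * (w - gaugeFactor A θ * ((t * x : ℝ) : ℂ)) := by
    rw [mul_sub, inv_mul_cancel_left₀ (gaugeFactor_ne_zero A θ)]
    push_cast
    ring
  rw [hsplit, two_mul]
  refine (norm_add_le _ _).trans (add_le_add ?_ ?_)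
  · rw [Complex.norm_real, Real.norm_eq_abs, abs_mul]
    exact (mul_le_mul ht hx (abs_nonneg _) hτ).trans_eq (mul_one τ)
  · calc _ = √Real.pi * ‖w - gaugeFactor A θ * ((t * x : ℝ) : ℂ)‖ := by
          rw [norm_mul, norm_inv, norm_gaugeFactor, one_div, inv_inv]
      _ ≤ √Real.pi * ((√(2 * Real.pi))⁻¹ * τ) := by gcongr
      _ ≤ τ := by
          rw [← mul_assoc]
          exact mul_le_of_le_one_left hτ hsqrt

namespace HasFlux

theorem norm_sub_mul_gaugeMode_add_le (hA : HasFlux A c) {f : Lp ℂ 2 arc} {p q : ℤ} {w : ℂ}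
    {θ : ℝ} (hw : HasSum (fun m => gaugeCoeff A c m f * gaugeMode A c m θ) w)
    (hs : Summable fun m => ‖⟪hA.basis m, pairRemainder hA.basis p q f⟫_ℂ‖) :
    ‖w - (⟪hA.basis p, f⟫_ℂ * gaugeMode A c p θ + ⟪hA.basis q, f⟫_ℂ * gaugeMode A c q θ)‖ ≤
      (√(2 * Real.pi))⁻¹ * ∑' m, ‖⟪hA.basis m, pairRemainder hA.basis p q f⟫_ℂ‖ := by
  simp only [← hA.inner_basis, ← smul_eq_mul (_ : ℂ) (gaugeMode A c _ θ)] at hw ⊢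
  have hrem := pairRemainder.hasSum_inner_smul hw p q
  have hnorm : ∀ m, ‖⟪hA.basis m, pairRemainder hA.basis p q f⟫_ℂ • gaugeMode A c m θ‖ =
      (√(2 * Real.pi))⁻¹ * ‖⟪hA.basis m, pairRemainder hA.basis p q f⟫_ℂ‖ := fun m => by
    rw [norm_smul, norm_gaugeMode, mul_comm]
  rw [← hrem.tsum_eq, ← tsum_mul_left]
  simp only [← hnorm]
  exact norm_tsum_le_tsum_norm (by simpa only [hnorm] using hs.mul_left _)

variable {ha : MemLp a ⊤ arc} {n : ℕ} {lam : ℝ} {f : Lp ℂ 2 arc}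

theorem summable_norm_inner_pairRemainder_and_tsum_le {hA : HasFlux A (1 / 2)} (hn : 0 < n)
    (hlow : (n : ℝ) ^ 2 < lam) (hupp : lam ≤ ((n : ℝ) + 1) ^ 2)
    (hf : f ∈ hA.lpEigenspace ha lam) (hf1 : ‖f‖ = 1) :
    (Summable fun m => ‖⟪hA.basis m, pairRemainder hA.basis n (-1 - n) f⟫_ℂ‖) ∧
      ∑' m, ‖⟪hA.basis m, pairRemainder hA.basis n (-1 - n) f⟫_ℂ‖ ≤ clusterConst ha / n :=
  pairRemainder.summable_norm_inner_and_tsum_le (Nat.cast_pos.2 hn) (fun _ => by positivity)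
    ((hasSum_inv_sq_shift _).add (hasSum_inv_sq_shift _)) (by omega) hf hf1
    fun _ => sq_le_mul_inv_sq_add_inv_sq hlow hupp

theorem abs_sub_circleMean_add_sq_le {hA : HasFlux A (1 / 2)} {g : ℝ → ℂ}
    (hg : HasWeakDeriv (fun θ => a θ) g) (hn : 0 < n) (hlarge : 2 * clusterConst ha ≤ n)
    (hf : f ∈ hA.lpEigenspace ha lam) (hf1 : ‖f‖ = 1)
    (hsymm : ‖⟪hA.basis (-1 - n), f⟫_ℂ‖ = ‖⟪hA.basis n, f⟫_ℂ‖)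
    (hrem : ‖pairRemainder hA.basis n (-1 - n) f‖ ≤ clusterConst ha / n) :
    |lam - (circleMean a + ((n : ℝ) + 1 / 2) ^ 2)| ≤
      ((∫ θ, ‖g θ‖ ∂arc) + 2 * (‖mulOp ha‖ * clusterConst ha)) / n := by
  have hn' : (0 : ℝ) < n := Nat.cast_pos.2 hn
  have hsmall : ‖pairRemainder hA.basis n (-1 - n) f‖ ≤ 1 / 2 :=
    hrem.trans (by rw [div_le_div_iff₀ hn' two_pos]; linarith)
  have hoff : ‖⟪hA.basis n, mulOp ha (hA.basis (-1 - n))⟫_ℂ‖ ≤ (∫ θ, ‖g θ‖ ∂arc) / n := by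
    have hweak := hA.abs_sub_mul_norm_inner_basis_mulOp_basis_le ha hg n (-1 - n)
    have hdist : (n : ℝ) ≤ |((n : ℤ) : ℝ) - ((-1 - n : ℤ) : ℝ)| := by
      push_cast
      exact le_abs.2 (Or.inl (by linarith))
    have hint : (2 * Real.pi)⁻¹ * ∫ θ, ‖g θ‖ ∂arc ≤ ∫ θ, ‖g θ‖ ∂arc :=
      mul_le_of_le_one_left (integral_nonneg fun _ => norm_nonneg _)
        (inv_le_one_of_one_le₀ (by linarith [Real.pi_gt_three]))
    rw [le_div_iff₀' hn']
    exact (mul_le_mul_of_nonneg_right hdist (norm_nonneg _)).trans (hweak.trans hint)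
  have hbound := pairRemainder.abs_eigenvalue_sub_le (by omega) hf hf1 hsymm hsmall
    (hA.inner_basis_mulOp_basis_self ha n)
  calc |lam - (circleMean a + ((n : ℝ) + 1 / 2) ^ 2)|
      ≤ (∫ θ, ‖g θ‖ ∂arc) / n + 2 * (‖mulOp ha‖ * (clusterConst ha / n)) := by
        refine hbound.trans ?_
        gcongr
    _ = _ := by ring

theorem exists_eigenpairExpansion (hA : HasFlux A (1 / 2)) {g : ℝ → ℂ}
    (hg : HasWeakDeriv (fun θ => a θ) g) (hn : 0 < n) (hlarge : 2 * clusterConst ha ≤ n)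
    (hlow : (n : ℝ) ^ 2 < lam) (hupp : lam ≤ ((n : ℝ) + 1) ^ 2)
    (hne : hA.lpEigenspace ha lam ≠ ⊥) :
    ∃ ϑ φ R, EigenpairExpansion A a
      ((∫ θ, ‖g θ‖ ∂arc) + 2 * (‖mulOp ha‖ * clusterConst ha) + 2 * clusterConst ha)
      lam n ϑ φ R := by
  obtain ⟨f, hf, hf1, hconj⟩ := hA.exists_unit_mem_lpEigenspace_inner_eq_conj ha hne
  obtain ⟨hs, hts⟩ := summable_norm_inner_pairRemainder_and_tsum_le hn hlow hupp hf hf1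
  obtain ⟨φ, hφ, hae, hpt⟩ := hA.exists_mem_eigenspace ha hf
  set z := ⟪hA.basis n, f⟫_ℂ with hz
  obtain ⟨ϑ, hϑ, hcos⟩ := exists_cos_mul_add_arg_eq (x := (n : ℝ) + 1 / 2)
    (by linarith [(Nat.one_le_cast (α := ℝ)).2 hn]) z
  have hsymm : ‖⟪hA.basis (-1 - n), f⟫_ℂ‖ = ‖z‖ := by rw [hconj, RCLike.norm_conj]
  have hrem := (norm_le_tsum_norm_inner hA.basis hs).trans hts
  have ht := (pairRemainder.abs_sqrt_two_mul_norm_inner_sub_one_le (by omega) hf1 hsymm).trans hrem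
  have hlam := abs_sub_circleMean_add_sq_le hg hn hlarge hf hf1 hsymm hrem
  have hK : 0 ≤ clusterConst ha / n := (norm_nonneg _).trans hrem
  have hG : 0 ≤ ((∫ θ, ‖g θ‖ ∂arc) + 2 * (‖mulOp ha‖ * clusterConst ha)) / n :=
    (abs_nonneg _).trans hlam
  refine ⟨ϑ, φ, fun θ => (gaugeFactor A θ)⁻¹ * φ θ - Real.cos ((n + 1 / 2) * (θ - ϑ)),
    ?_, hϑ, hφ, ?_, fun θ => ?_, fun θ => ?_⟩
  · rw [Int.cast_natCast, Nat.abs_cast, add_div]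
    exact hlam.trans (le_add_of_nonneg_right (by rw [mul_div_assoc]; positivity))
  · rw [← integral_arc, ← one_pow (M := ℝ) 2, ← hf1, norm_sq_eq_integral]
    refine integral_congr_ae ?_
    filter_upwards [hae] with θ hθ
    rw [hθ]
  · rw [Int.cast_natCast, add_sub_cancel, mul_inv_cancel_left₀ (gaugeFactor_ne_zero A θ)]
  · have hφθ := hA.norm_sub_mul_gaugeMode_add_le (hpt θ) hs
    rw [hconj, ← hz, mul_gaugeMode_add_conj_mul_gaugeMode, Int.cast_natCast, hcos] at hφθ
    rw [Int.cast_natCast, Nat.abs_cast, add_div, mul_div_assoc 2]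
    refine (norm_inv_gaugeFactor_mul_sub_le (Real.abs_cos_le_one _) ht
      (hφθ.trans ?_)).trans (le_add_of_nonneg_left hG)
    gcongr

theorem exists_expansion_constants (hA : HasFlux A (1 / 2)) (ha : MemLp a ⊤ arc) {g : ℝ → ℂ}
    (hg : HasWeakDeriv (fun θ => a θ) g) :
    ∃ (C : ℝ) (N : ℕ), ‖mulOp ha‖ + 1 < N ∧ ∀ (j : ℤ) (lam : ℝ), N ≤ foldIndex j →
      (foldIndex j : ℝ) ^ 2 < lam → lam ≤ ((foldIndex j : ℝ) + 1) ^ 2 →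
      hA.lpEigenspace ha lam ≠ ⊥ → ∃ ϑ φ R, EigenpairExpansion A a C lam j ϑ φ R := by
  obtain ⟨N, hN⟩ := exists_nat_gt (max (‖mulOp ha‖ + 1) (2 * clusterConst ha))
  obtain ⟨hNV, hNK⟩ := max_lt_iff.1 hN
  have hN0 : 0 < N := by
    have : (0 : ℝ) < N := by linarith [norm_nonneg (mulOp ha)]
    exact_mod_cast this
  refine ⟨2 * ((∫ θ, ‖g θ‖ ∂arc) + 2 * (‖mulOp ha‖ * clusterConst ha) + 2 * clusterConst ha),
    N, hNV, fun j lam hj hlow hupp hne => ?_⟩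
  obtain ⟨ϑ, φ, R, h⟩ := hA.exists_eigenpairExpansion hg (hN0.trans_le hj)
    (hNK.le.trans (Nat.cast_le.2 hj)) hlow hupp hne
  exact ⟨ϑ, φ, R, h.of_foldIndex (hN0.trans_le hj)⟩

end HasFlux

end Asymptotics

theorem HasFlux.exists_equiv_eigenpairExpansion {A a : ℝ → ℝ} (hA : HasFlux A (1 / 2))
    (ha : MemLp a ⊤ arc) {g : ℝ → ℂ} (hg : HasWeakDeriv (fun θ => a θ) g) {μ : ℕ+ → ℝ}
    (hμ : IsEigenvalueSequence A a μ) :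
    ∃ (C : ℝ) (kstar ℓ : ℕ) (σ : {j : ℤ // (ℓ : ℤ) ≤ |j|} ≃ {k : ℕ+ // kstar < (k : ℕ)}),
      1 ≤ ℓ ∧ ∀ j, ∃ ϑ φ R, EigenpairExpansion A a C (μ (σ j)) j ϑ φ R := by
  obtain ⟨u, hu⟩ := hA.exists_eigenbasis_of_isEigenvalueSequence ha hμ
  obtain ⟨C, N, hN, hexpand⟩ := hA.exists_expansion_constants ha hg
  have hwindow : ∀ n, N ≤ n →
      {k | ((n : ℕ) : ℝ) ^ 2 < μ k ∧ μ k ≤ ((n + 1 : ℕ) : ℝ) ^ 2}.ncard = 2 := fun n hn => by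
    rw [Nat.cast_add_one]
    exact ncard_window_eq_two (isSymmetric_mulOp ha) hu (hN.trans_le (Nat.cast_le.2 hn))
  have hmono : Monotone fun n : ℕ => (n : ℝ) ^ 2 := fun m n h => by dsimp only; gcongr
  obtain ⟨kstar, σ, hσ⟩ := exists_equiv_of_ncard_eq_two hμ.mono hμ.tendsto hmono hwindow
  refine ⟨C, kstar, N + 1, σ, N.succ_pos, fun j => ?_⟩
  obtain ⟨hlow, hupp⟩ := hσ j
  exact hexpand j _ (le_foldIndex j.2) hlow (hupp.trans_eq (by rw [Nat.cast_add_one]))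
    ((Submodule.ne_bot_iff _).2 ⟨_, hu _, u.orthonormal.ne_zero _⟩)

end CircleMagnetic

theorem lemmaB5_general (a A : ℝ → ℝ) (ha : MemLp a ⊤ CircleMagnetic.arc)
    (ha' : ∃ g : ℝ → ℂ, Integrable g CircleMagnetic.arc ∧
      CircleMagnetic.HasWeakDeriv (fun θ => (a θ : ℂ)) g)
    (hper : Function.Periodic A (2 * Real.pi)) (hA : MemLp A ⊤ CircleMagnetic.arc)
    (hhalf : ∃ m : ℤ, CircleMagnetic.circleMean A = (m : ℝ) + 1 / 2) :
    (∃ μ : ℕ+ → ℝ, CircleMagnetic.IsEigenvalueSequence A a μ) ∧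
    ∀ μ : ℕ+ → ℝ, CircleMagnetic.IsEigenvalueSequence A a μ →
      ∃ (kstar ℓ : ℕ) (lam : ℤ → ℝ), 1 ≤ ℓ ∧
        (∃ σ : {j : ℤ // (ℓ : ℤ) ≤ |j|} ≃ {k : ℕ+ // kstar < (k : ℕ)},
          ∀ j : {j : ℤ // (ℓ : ℤ) ≤ |j|}, lam (j : ℤ) = μ (σ j : ℕ+)) ∧
        (∃ C : ℝ, ∀ j : ℤ, (ℓ : ℤ) ≤ |j| →
          |lam j - (CircleMagnetic.circleMean a + ((j : ℝ) + 1 / 2) ^ 2)| ≤ C / |(j : ℝ)|) ∧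
        ∃ (ϑ : ℤ → ℝ) (φ R : ℤ → ℝ → ℂ),
          (∀ j : ℤ, (ℓ : ℤ) ≤ |j| →
            ϑ j ∈ Set.Icc 0 (2 * Real.pi) ∧
            φ j ∈ CircleMagnetic.eigenspace A a (lam j : ℂ) ∧
            (∫ θ in (0 : ℝ)..(2 * Real.pi), ‖φ j θ‖ ^ 2) = 1 ∧
            ∀ θ ∈ Set.Icc (0 : ℝ) (2 * Real.pi),
              φ j θ = ((1 / Real.sqrt Real.pi : ℝ) : ℂ)
                * Complex.exp (-Complex.I * ((∫ t in (0 : ℝ)..θ, A t : ℝ) : ℂ))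
                * ((Real.cos (((j : ℝ) + 1 / 2) * (θ - ϑ j)) : ℂ) + R j θ)) ∧
          ∃ C : ℝ, ∀ j : ℤ, (ℓ : ℤ) ≤ |j| → ∀ θ ∈ Set.Icc (0 : ℝ) (2 * Real.pi),
            ‖R j θ‖ ≤ C / |(j : ℝ)| := by
  obtain ⟨g, -, hg⟩ := ha'
  have hflux : CircleMagnetic.HasFlux A (1 / 2) := ⟨hper, hA, hhalf⟩
  obtain ⟨-, ν, hν, -⟩ := hflux.exists_isEigenvalueSequence ha
  refine ⟨⟨ν, hν⟩, fun μ hμ => ?_⟩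
  obtain ⟨C, kstar, ℓ, σ, hℓ, hσ⟩ := hflux.exists_equiv_eigenpairExpansion ha hg hμ
  let lam : ℤ → ℝ := Function.extend Subtype.val (fun j => μ (σ j)) 0
  have hlam : ∀ j : {j : ℤ // (ℓ : ℤ) ≤ |j|}, lam j = μ (σ j) :=
    Subtype.val_injective.extend_apply _ _
  have hexpand : ∀ j : ℤ, (ℓ : ℤ) ≤ |j| →
      ∃ ϑ φ R, CircleMagnetic.EigenpairExpansion A a C (lam j) j ϑ φ R := fun j hj => by
    rw [hlam ⟨j, hj⟩]
    exact hσ ⟨j, hj⟩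
  choose! ϑ φ R h using hexpand
  exact ⟨kstar, ℓ, lam, hℓ, ⟨σ, hlam⟩, ⟨C, fun j hj => (h j hj).abs_eigenvalue_sub_le⟩, ϑ, φ, R,
    fun j hj => ⟨(h j hj).phase_mem, (h j hj).mem_eigenspace, (h j hj).integral_norm_sq,
      fun θ _ => (h j hj).eq_gaugeFactor_mul θ⟩,
    C, fun j hj θ _ => (h j hj).norm_remainder_le θ⟩

theorem lemmaB5 (a A : ℝ → ℝ) (ha : CircleMagnetic.MemW1Infty a)
    (hA : CircleMagnetic.MemW1Infty A)
    (hhalf : ∃ m : ℤ, CircleMagnetic.circleMean A = (m : ℝ) + 1 / 2) :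
    (∃ μ : ℕ+ → ℝ, CircleMagnetic.IsEigenvalueSequence A a μ) ∧
    ∀ μ : ℕ+ → ℝ, CircleMagnetic.IsEigenvalueSequence A a μ →
      ∃ (kstar ℓ : ℕ) (lam : ℤ → ℝ), 1 ≤ ℓ ∧
        -- the families `(μ_k)_{k > kstar}` and `(lam_j)_{|j| ≥ ℓ}` agree, with multiplicities
        (∃ σ : {j : ℤ // (ℓ : ℤ) ≤ |j|} ≃ {k : ℕ+ // kstar < (k : ℕ)},
          ∀ j : {j : ℤ // (ℓ : ℤ) ≤ |j|}, lam (j : ℤ) = μ (σ j : ℕ+)) ∧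
        (∃ C : ℝ, ∀ j : ℤ, (ℓ : ℤ) ≤ |j| →
          |lam j - (CircleMagnetic.circleMean a + ((j : ℝ) + 1 / 2) ^ 2)| ≤ C / |(j : ℝ)|) ∧
        ∃ (ϑ : ℤ → ℝ) (φ R : ℤ → ℝ → ℂ),
          (∀ j : ℤ, (ℓ : ℤ) ≤ |j| →
            ϑ j ∈ Set.Icc 0 (2 * Real.pi) ∧
            φ j ∈ CircleMagnetic.eigenspace A a (lam j : ℂ) ∧
            (∫ θ in (0 : ℝ)..(2 * Real.pi), ‖φ j θ‖ ^ 2) = 1 ∧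
            ∀ θ ∈ Set.Icc (0 : ℝ) (2 * Real.pi),
              φ j θ = ((1 / Real.sqrt Real.pi : ℝ) : ℂ)
                * Complex.exp (-Complex.I * ((∫ t in (0 : ℝ)..θ, A t : ℝ) : ℂ))
                * ((Real.cos (((j : ℝ) + 1 / 2) * (θ - ϑ j)) : ℂ) + R j θ)) ∧
          ∃ C : ℝ, ∀ j : ℤ, (ℓ : ℤ) ≤ |j| → ∀ θ ∈ Set.Icc (0 : ℝ) (2 * Real.pi),
            ‖R j θ‖ ≤ C / |(j : ℝ)| := by
  obtain ⟨g, hg, hweak⟩ := ha.weakDeriv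
  exact lemmaB5_general a A ha.memLp ⟨_, hg.ofReal.integrable le_top, hweak⟩
    hA.periodic hA.memLp hhalf
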